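/- Theorem 1 (affine case). Let $k\ge 0$ and $G=(\mathbb C^*)^k\times SL_2(\mathbb C)$. For $\chi\in\mathbb Z^k$ (regarded as the character $t\mapsto t_1^{\chi_1}\cdots t_k^{\chi_k}$ of $(\mathbb C^*)^k$) and an integer $n\ge 0$, let $V_{\chi,n}$ be the space of binary forms of degree $n$ in $x,y$, on which $G$ acts by $$\Bigl(t,\begin{pmatrix}\kappa&\lambda\\ \mu&\nu\end{pmatrix}\Bigr)\cdot f(x,y)=\chi(t)\,f(\kappa x+\mu y,\ \lambda x+\nu y).$$ Let $V=\bigoplus_{i=1}^s V_{\chi_i,n_i}$ and $v=(v_i)_{i=1}^s\in V$, and let $S=\{i : v_i\ne 0\}$ (components equal to zero are discarded). For $i\in S$ and $a\in\mathbb C$ let $e_i(a)$ be the exponent of the linear form $ax+y$ in the factorization $v_i=c_i\,x^{\,n_i-\sum_a e_i(a)}\prod_{a\in\mathbb C}(ax+y)^{e_i(a)}$, $c_i\neq 0$. Let $M\subset\mathbb Q^{k+1}$ be the convex cone spanned by the characteristic points $(\chi_i,n_i)$, $i\in S$. A face $F$ of $M$ (where $M$ itself counts as a face) is called admissible if there is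 a vector $R=(r_1,\dots,r_k,p)\in\mathbb Q^{k+1}$ with $p<0$ that is orthogonal to $F$, is not orthogonal to any face of $M$ strictly containing $F$, and satisfies $\langle(\chi_i,n_i),R\rangle\ge 0$ for all $i\in S$. For an admissible face $F$ put $I(F)=\{i\in S : (\chi_i,n_i)\in F\}$. Then the Zariski closure $\overline{Gv}\subset V$ contains only finitely many $G$-orbits if and only if, for every admissible face $F$ whose dimension is maximal among all admissible faces of $M$, and for every integer vector $\beta=(\beta_i)_{i\in I(F)}$ with $\sum_{i\in I(F)}\beta_i\chi_i=0$, one has $$\sum_{i\in I(F)}e_i(a)\,\beta_i=0\qquad\text{for all } a\in\mathbb C.$$ -/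

import Mathlib

namespace TorusSL2

noncomputable section

/-- The group `(ℂˣ)^k × SL₂(ℂ)`. -/
abbrev Grp (k : ℕ) : Type :=
  (Fin k → ℂˣ) × Matrix.SpecialLinearGroup (Fin 2) ℂ

/-- The character `t ↦ ∏ⱼ tⱼ ^ χⱼ` of the torus `(ℂˣ)^k` given by `χ ∈ ℤ^k`. -/
def character {k : ℕ} (χ : Fin k → ℤ) : (Fin k → ℂˣ) →* ℂˣ where
  toFun t := ∏ j, t j ^ χ j
  map_one' := by simp
  map_mul' s t := by simp [mul_zpow, Finset.prod_mul_distrib]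

/-- Binary forms of degree `n`: homogeneous polynomials of degree `n` in the variables
`x = X 0` and `y = X 1`. -/
abbrev BinaryForm (n : ℕ) : Type :=
  MvPolynomial.homogeneousSubmodule (Fin 2) ℂ n

/-- The linear substitution `f(x, y) ↦ f(κ x + μ y, λ x + ν y)` for the matrix
with rows `(κ, λ)` and `(μ, ν)`. -/
def subst (A : Matrix (Fin 2) (Fin 2) ℂ) :
    MvPolynomial (Fin 2) ℂ →ₐ[ℂ] MvPolynomial (Fin 2) ℂ :=
  MvPolynomial.aeval fun j =>
    MvPolynomial.C (A 0 j) * MvPolynomial.X 0 + MvPolynomial.C (A 1 j) * MvPolynomial.X 1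

theorem subst_one : subst 1 = AlgHom.id ℂ (MvPolynomial (Fin 2) ℂ) := by
  ext j : 1
  fin_cases j <;> simp [subst]

theorem subst_mul (A B : Matrix (Fin 2) (Fin 2) ℂ) :
    subst (A * B) = (subst A).comp (subst B) := by
  ext j : 1
  simp only [subst, MvPolynomial.aeval_X, AlgHom.comp_apply, map_add, map_mul,
    MvPolynomial.algHom_C, MvPolynomial.algebraMap_eq, Matrix.mul_apply, Fin.sum_univ_two]
  ring

theorem subst_isHomogeneous (A : Matrix (Fin 2) (Fin 2) ℂ) {n : ℕ}
    {f : MvPolynomial (Fin 2) ℂ} (hf : f.IsHomogeneous n) : (subst A f).IsHomogeneous n := by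
  have h := hf.aeval (n := 1) (fun j => MvPolynomial.C (A 0 j) * MvPolynomial.X (0 : Fin 2) +
    MvPolynomial.C (A 1 j) * MvPolynomial.X 1) (fun j =>
      ((MvPolynomial.isHomogeneous_C_mul_X (A 0 j) 0).add
        (MvPolynomial.isHomogeneous_C_mul_X (A 1 j) 1)))
  rw [one_mul] at h
  exact h

/-- The simple module `V_{χ, n}`: the space of binary forms of degree `n`, on which `(t, A)` acts
by `f(x, y) ↦ χ(t) f(κ x + μ y, λ x + ν y)`, where `A` has rows `(κ, λ)` and `(μ, ν)`. -/
def simpleRep {k : ℕ} (χ : Fin k → ℤ) (n : ℕ) : Representation ℂ (Grp k) (BinaryForm n) where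
  toFun g :=
    { toFun := fun f => ⟨((character χ g.1 : ℂˣ) : ℂ) • subst (g.2 : Matrix (Fin 2) (Fin 2) ℂ) f,
        Submodule.smul_mem _ _ (subst_isHomogeneous _ f.2)⟩
      map_add' := fun f f' => Subtype.ext (by simp)
      map_smul' := fun c f => Subtype.ext (by simp [smul_comm c]) }
  map_one' := LinearMap.ext fun f => Subtype.ext (by simp [subst_one])
  map_mul' g h := LinearMap.ext fun f => Subtype.ext (by simp [subst_mul, mul_smul])

/-- The underlying space of `V = ⨁ᵢ V_{χᵢ, nᵢ}`. -/
abbrev Space {s : ℕ} (n : Fin s → ℕ) : Type :=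
  ∀ i, BinaryForm (n i)

/-- The linear action of `(ℂˣ)^k × SL₂(ℂ)` on `V = ⨁ᵢ V_{χᵢ, nᵢ}`, componentwise. -/
def rep {k s : ℕ} (χ : Fin s → Fin k → ℤ) (n : Fin s → ℕ) :
    Representation ℂ (Grp k) (Space n) where
  toFun g := LinearMap.pi fun i => (simpleRep (χ i) (n i) g).comp (LinearMap.proj i)
  map_one' := LinearMap.ext fun v => funext fun i => by simp
  map_mul' g h := LinearMap.ext fun v => funext fun i => by simp

/-- The orbit of `w` under the linear action of `(ℂˣ)^k × SL₂(ℂ)`. -/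
def orbit {k s : ℕ} (χ : Fin s → Fin k → ℤ) (n : Fin s → ℕ) (w : Space n) : Set (Space n) :=
  Set.range fun g : Grp k => rep χ n g w

/-- The algebra of polynomial functions on a complex vector space: the subalgebra of all functions
generated by the linear functionals. -/
def polyFun (V : Type*) [AddCommGroup V] [Module ℂ V] : Subalgebra ℂ (V → ℂ) :=
  Algebra.adjoin ℂ (Set.range fun φ : Module.Dual ℂ V => (φ : V → ℂ))

/-- The Zariski closure of a subset of a finite-dimensional complex vector space: the common zeros
of the polynomial functions that vanish on the subset. -/
def zariskiClosure {V : Type*} [AddCommGroup V] [Module ℂ V] (S : Set V) : Set V :=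
  {w | ∀ f ∈ polyFun V, (∀ u ∈ S, f u = 0) → f w = 0}

/-- The root multiplicity `e(a)` of a nonzero binary form `f`: the exponent of `a x + y` in the
factorization `f = c x^(n - e(∞)) ∏ₐ (a x + y)^(e(a))`. -/
def rootMult {n : ℕ} (f : BinaryForm n) (a : ℂ) : ℕ :=
  multiplicity (MvPolynomial.C a * MvPolynomial.X 0 + MvPolynomial.X 1)
    (f : MvPolynomial (Fin 2) ℂ)

/-- The characteristic point `(χ, n)` in `ℚ^k × ℚ`. -/
def charPoint {k : ℕ} (χ : Fin k → ℤ) (n : ℕ) : (Fin k → ℚ) × ℚ :=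
  (fun j => (χ j : ℚ), (n : ℚ))

/-- The standard scalar product on `ℚ^k × ℚ = ℚ^(k+1)`. -/
def pairing {k : ℕ} (u w : (Fin k → ℚ) × ℚ) : ℚ :=
  ∑ j, u.1 j * w.1 j + u.2 * w.2

/-- The cone `M` spanned by the characteristic points `(χᵢ, nᵢ)` of the nonzero components
of `v`. -/
def charCone {k s : ℕ} (χ : Fin s → Fin k → ℤ) {n : Fin s → ℕ} (v : Space n) :
    PointedCone ℚ ((Fin k → ℚ) × ℚ) :=
  PointedCone.hull ℚ {P | ∃ i, v i ≠ 0 ∧ P = charPoint (χ i) (n i)}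

/-- `R` is orthogonal to the cone `F`. -/
def IsOrthogonalTo {k : ℕ} (R : (Fin k → ℚ) × ℚ) (F : PointedCone ℚ ((Fin k → ℚ) × ℚ)) : Prop :=
  ∀ P ∈ F, pairing P R = 0

/-- A face `F` of the cone `M` (the cone itself counts as a face) is admissible if there is
`R = (r₁, …, r_k, p)` with `p < 0` which is orthogonal to `F`, is not orthogonal to any strictly
larger face, and has nonnegative scalar product with all characteristic points. -/
def IsAdmissibleFace {k s : ℕ} (χ : Fin s → Fin k → ℤ) {n : Fin s → ℕ} (v : Space n)
    (F : PointedCone ℚ ((Fin k → ℚ) × ℚ)) : Prop :=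
  F.IsFaceOf (charCone χ v) ∧
    ∃ R : (Fin k → ℚ) × ℚ, R.2 < 0 ∧ IsOrthogonalTo R F ∧
      (∀ F' : PointedCone ℚ ((Fin k → ℚ) × ℚ),
        F'.IsFaceOf (charCone χ v) → F < F' → ¬ IsOrthogonalTo R F') ∧
      ∀ i, v i ≠ 0 → 0 ≤ pairing (charPoint (χ i) (n i)) R

/-- The dimension of a cone: the dimension of its linear span. -/
def coneDim {k : ℕ} (F : PointedCone ℚ ((Fin k → ℚ) × ℚ)) : ℕ :=
  Module.finrank ℚ (Submodule.span ℚ (F : Set ((Fin k → ℚ) × ℚ)))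

/-- An admissible face whose dimension is the largest among all admissible faces. -/
def IsMaxAdmissibleFace {k s : ℕ} (χ : Fin s → Fin k → ℤ) {n : Fin s → ℕ} (v : Space n)
    (F : PointedCone ℚ ((Fin k → ℚ) × ℚ)) : Prop :=
  IsAdmissibleFace χ v F ∧ ∀ F', IsAdmissibleFace χ v F' → coneDim F' ≤ coneDim F

open scoped Classical in
/-- The set of indices of the characteristic points lying on the face `F`, where only nonzero
components of `v` are taken into account. -/
def faceIndices {k s : ℕ} (χ : Fin s → Fin k → ℤ) {n : Fin s → ℕ} (v : Space n)
    (F : PointedCone ℚ ((Fin k → ℚ) × ℚ)) : Finset (Fin s) :=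
  {i | v i ≠ 0 ∧ charPoint (χ i) (n i) ∈ F}

end

end TorusSL2

/-! # Finiteness of the number of orbits in an orbit closure of `(ℂˣ)^k × SL₂(ℂ)`

Write `Fᵢ(X) = vᵢ(1, X)`, so that `eᵢ(a)` is the multiplicity of the root `-a` of `Fᵢ`.

*The points of the closure.* A point `w` of the Zariski closure of the orbit `Gv` is the reduction
of a `K`-point of the orbit, where `K` is a field with a place in `ℂ`: an ultrapower of `ℂ` along
an ultrafilter on the group contains a generic point of the orbit closure, and the homomorphism
"value at `w`" on the polynomial functions of that point extends to a place of `K` by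
`exists_place`. The Cartan decomposition `exists_cartan` over the valuation ring brings the
`K`-point of `SL₂` into the form `diag(d, d⁻¹) * unip b * (unip β * g)`, where `d⁻¹` is integral,
`b` reduces to zero, and `unip β * g` is a complex matrix: `w` comes, up to the group, from the
translate of `v` by `unip β * g` and the one-parameter degeneration given by `d`, the torus
coordinates and `b`. If `Fᵢ(β) ≠ 0` for all `i` with `vᵢ ≠ 0` (a generic translate), then either
`d` is a unit and `w` arises by discarding components of `v`, or `w` is equivalent to the point
`limitPoint χ v R β` with components `Fᵢ(β) x ^ nᵢ` for `(χᵢ, nᵢ)` orthogonal to some vector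
`R = (r, p)` with `p < 0` that is nonnegative on the characteristic points; such an `R` is obtained
from the valuations of `d` and of the torus coordinates (`exists_rational_weight`). The remaining
translates are finitely many, and each of them contributes finitely many orbits. This is
`mem_zariskiClosure_cases`. Points are recognized as equivalent through `mem_orbit_of_coeff`: a
scaling of the coefficients comes from the torus if it satisfies all the multiplicative relations
between the weights, because `ℂˣ` is divisible.

*Orbits of the limit points.* Conversely all points `limitPoint χ v R β` lie in the closure
(`limitPoint_mem_zariskiClosure`). For a fixed `R`, the torus and the diagonal matrices act on
them by scaling the components, and the invariants are the monomials `∏ Fᵢ(β) ^ βᵢ` over the indices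
orthogonal to `R` with `∑ βᵢ χᵢ = 0` (then `∑ βᵢ nᵢ = 0` holds automatically, since `p ≠ 0`). Such a
rational function of `β` is constant exactly if `∑ eᵢ(a) βᵢ = 0` for all `a`. If all of them are
constant, the generic limit points form a single orbit for each of the finitely many sets of
indices orthogonal to some `R` (`limitPoint_mem_orbit`); if one of them is not constant, it separates
infinitely many orbits (`prod_eval_eq_of_limitPoint_mem_orbit`).

*Faces.* The admissible faces are the intersections of the cone with the hyperplanes orthogonal to
such vectors `R`. The set of indices orthogonal to `R` is contained in one belonging to an
admissible face of maximal dimension: `R` can be moved in a horizontal direction until it meets a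
further facet of the dual cone, as long as the span of the face and of the vector `(0, 1)` does not
contain all characteristic points. As relations on a set of indices extend by zero to larger sets,
it suffices to consider the admissible faces of maximal dimension
(`sum_rootMult_eq_zero_of_forall_isMaxAdmissibleFace`). -/

namespace TorusSL2

/-! ### Places with values in an algebraically closed field -/

section Place

open Polynomial

/-- A subalgebra `M` that is maximal among those not containing `e` contains every `p` for which
`e` is not a polynomial in `p` with coefficients in `M`. -/
theorem mem_of_maximal_avoiding {k A : Type*} [CommRing k] [CommRing A] [Algebra k A]
    {e : A} {M : Subalgebra k A} (hM : ∀ N : Subalgebra k A, M ≤ N → e ∉ N → N ≤ M) {p : A}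
    (hp : ∀ P : M[X], aeval p P ≠ e) : p ∈ M := by
  let N : Subalgebra k A := (Algebra.adjoin M {p}).restrictScalars k
  refine hM N (fun m hm => ?_) ?_ ?_
  · exact (Algebra.adjoin M {p}).algebraMap_mem ⟨m, hm⟩
  · intro h
    have h' : e ∈ Algebra.adjoin M {p} := h
    rw [Algebra.adjoin_singleton_eq_range_aeval] at h'
    obtain ⟨P, hP⟩ := h'
    exact hp P hP
  · show p ∈ Algebra.adjoin M {p}
    exact Algebra.subset_adjoin (Set.mem_singleton p)

theorem exists_maximal_avoiding {k A : Type*} [CommRing k] [CommRing A] [Algebra k A]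
    {e : A} {A₀ : Subalgebra k A} (h₀ : e ∉ A₀) :
    ∃ M : Subalgebra k A, A₀ ≤ M ∧ e ∉ M ∧ ∀ N : Subalgebra k A, M ≤ N → e ∉ N → N ≤ M := by
  obtain ⟨M, hAM, hM⟩ := zorn_le_nonempty₀ {N : Subalgebra k A | e ∉ N} (by
    intro c hc hchain y hy
    have : Nonempty c := ⟨⟨y, hy⟩⟩
    refine ⟨⨆ N : c, N.1, ?_, fun z hz => le_iSup (fun N : c => N.1) ⟨z, hz⟩⟩
    intro he
    have hd : Directed (· ≤ ·) fun N : c => N.1 := hchain.directed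
    have he' : e ∈ ((⨆ N : c, N.1 : Subalgebra k A) : Set A) := he
    rw [Subalgebra.coe_iSup_of_directed hd] at he'
    obtain ⟨N, hN⟩ := Set.mem_iUnion.1 he'
    exact hc N.2 hN) A₀ h₀
  exact ⟨M, hAM, hM.1, fun N h1 h2 => hM.2 h2 h1⟩

variable {k K : Type*} [Field k] [Field K] [Algebra k K]

theorem eq_zero_of_zero_mem {M : Subalgebra k (K × k)} (hM : ((0 : K), (1 : k)) ∉ M) {c : k}
    (h : ((0 : K), c) ∈ M) : c = 0 := by
  by_contra hc
  exact hM (by simpa [hc] using M.smul_mem h c⁻¹)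

/-- If `M` is the graph of a homomorphism from a subring of `K` to `k`, and is maximal with this
property, then that subring is local: the elements with nonzero image are invertible in it. -/
theorem inv_mem_of_maximal_avoiding {M : Subalgebra k (K × k)} (hM₀ : ((0 : K), (1 : k)) ∉ M)
    (hM : ∀ N : Subalgebra k (K × k), M ≤ N → ((0 : K), (1 : k)) ∉ N → N ≤ M) {p : K × k}
    (hp : p ∈ M) (h0 : p.2 ≠ 0) : (p.1⁻¹, p.2⁻¹) ∈ M := by
  have h1 : p.1 ≠ 0 := fun h =>
    h0 (eq_zero_of_zero_mem hM₀ (c := p.2) (by rw [← h]; exact hp))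
  set q : K × k := (p.1⁻¹, p.2⁻¹)
  have hpp : p * q = 1 := Prod.ext (mul_inv_cancel₀ h1) (mul_inv_cancel₀ h0)
  refine mem_of_maximal_avoiding hM fun P hP => ?_
  have key : p ^ P.natDegree * aeval q P ∈ M := by
    rw [aeval_eq_sum_range, Finset.mul_sum]
    refine M.sum_mem fun i hi => ?_
    obtain ⟨j, hj⟩ := Nat.exists_eq_add_of_le (Nat.lt_succ_iff.1 (Finset.mem_range.1 hi))
    have : p ^ P.natDegree * (P.coeff i • q ^ i) = (P.coeff i : K × k) * p ^ j := by
      rw [hj, Algebra.smul_def, pow_add,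
        show p ^ i * p ^ j * (algebraMap M (K × k) (P.coeff i) * q ^ i) =
          algebraMap M (K × k) (P.coeff i) * p ^ j * (p * q) ^ i by rw [mul_pow]; ring,
        hpp, one_pow, mul_one]
      rfl
    rw [this]
    exact M.mul_mem (P.coeff i).2 (M.pow_mem hp _)
  rw [hP] at key
  have h2 := eq_zero_of_zero_mem hM₀ (c := p.2 ^ P.natDegree) (by
    convert key using 1
    ext <;> simp)
  exact pow_ne_zero _ h0 h2

/-- The extension theorem for places. A subalgebra of `K × k` that does not contain `(0, 1)` is the
graph of a homomorphism from a subring of `K` to `k`; it extends to a homomorphism from a valuation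
ring of `K` whose kernel is the maximal ideal. -/
theorem exists_place [IsAlgClosed k] (A : Subalgebra k (K × k)) (hA : ((0 : K), (1 : k)) ∉ A) :
    ∃ (O : ValuationSubring K) (φ : O →+* k), IsLocalHom φ ∧
      ∀ p ∈ A, ∃ h : p.1 ∈ O, φ ⟨p.1, h⟩ = p.2 := by
  obtain ⟨M, hAM, hM₀, hM⟩ := exists_maximal_avoiding hA
  let f : M →+* K := (RingHom.fst K k).comp M.val.toRingHom
  let g : M →+* k := (RingHom.snd K k).comp M.val.toRingHom
  have hf : Function.Injective f := by
    refine (injective_iff_map_eq_zero f).2 fun m hm => ?_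
    have hm1 : m.1.1 = 0 := hm
    have : m.1.2 = 0 := eq_zero_of_zero_mem hM₀ (by rw [← hm1]; exact m.2)
    exact Subtype.ext (Prod.ext hm1 this)
  have hg : Function.Surjective g := fun c => ⟨algebraMap k M c, rfl⟩
  let e : M ≃+* f.range := RingEquiv.ofBijective f.rangeRestrict
    ⟨fun a b h => hf (congrArg Subtype.val h), f.rangeRestrict_surjective⟩
  have he : ∀ m, ((e m : f.range) : K) = f m := fun m => rfl
  let φ : f.range →+* k := g.comp e.symm.toRingHom
  have hφe : ∀ m, φ (e m) = g m := fun m => by simp [φ]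
  have hφ : IsLocalHom φ := by
    refine ⟨fun y hy => ?_⟩
    obtain ⟨m, rfl⟩ := e.surjective y
    rw [hφe] at hy
    have h0 : m.1.2 ≠ 0 := hy.ne_zero
    have h1 : m.1.1 ≠ 0 := fun h =>
      h0 (eq_zero_of_zero_mem hM₀ (c := m.1.2) (by rw [← h]; exact m.2))
    refine IsUnit.map e (IsUnit.of_mul_eq_one
      ⟨_, inv_mem_of_maximal_avoiding hM₀ hM m.2 h0⟩ ?_)
    exact Subtype.ext (Prod.ext (mul_inv_cancel₀ h1) (mul_inv_cancel₀ h0))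
  have hloc : IsLocalRing f.range := RingHom.domain_isLocalRing φ
  let R : LocalSubring K := { toSubring := f.range, isLocalRing := hloc }
  have hmax : IsMax R := by
    rintro B ⟨hle, hdom⟩
    suffices hBR : B.toSubring ≤ R.toSubring from
      (LocalSubring.toSubring_injective (le_antisymm hle hBR)).ge
    intro x hx
    -- `I` is the ideal of the relations satisfied by `x`, reduced to the residue field.
    let I : Ideal k[X] := (RingHom.ker (eval₂RingHom f x)).map (mapRingHom g)
    have hI : ∀ Q ∈ I, ∃ P : M[X], P.eval₂ f x = 0 ∧ P.map g = Q := by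
      intro Q hQ
      obtain ⟨P, hP, rfl⟩ :=
        (Ideal.mem_map_iff_of_surjective _ (Polynomial.map_surjective g hg)).1 hQ
      exact ⟨P, hP, rfl⟩
    have hItop : I ≠ ⊤ := by
      intro htop
      obtain ⟨P, hP, hP1⟩ := hI 1 (htop ▸ Submodule.mem_top)
      let b : M → B.toSubring := fun m => Subring.inclusion hle (e m)
      have hb : ∀ i, i ≠ 0 → ¬ IsUnit (b (P.coeff i)) := by
        intro i hi hu
        have h2 := ((hdom.1 _ hu).map φ).ne_zero
        rw [hφe] at h2
        have h3 : (P.map g).coeff i = 0 := by rw [hP1, coeff_one, if_neg hi]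
        rw [coeff_map] at h3
        exact h2 h3
      have hb0 : IsUnit (b (P.coeff 0)) := by
        have h3 : (P.map g).coeff 0 = 1 := by rw [hP1, coeff_one, if_pos rfl]
        rw [coeff_map, ← hφe] at h3
        exact (hφ.1 _ (h3 ▸ isUnit_one)).map (Subring.inclusion hle)
      have hsum : b (P.coeff 0) +
          ∑ i ∈ Finset.range P.natDegree, b (P.coeff (i + 1)) * (⟨x, hx⟩ : B.toSubring) ^ (i + 1)
            = 0 := by
        rw [eval₂_eq_sum_range, Finset.sum_range_succ'] at hP
        apply Subtype.ext
        simp only [Subring.coe_add, Subring.coe_mul, AddSubmonoidClass.coe_finsetSum,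
          SubmonoidClass.coe_pow, ZeroMemClass.coe_zero]
        rw [add_comm]
        simpa [b, he] using hP
      have hmem : b (P.coeff 0) ∈ IsLocalRing.maximalIdeal B.toSubring := by
        rw [eq_neg_of_add_eq_zero_left hsum]
        refine neg_mem (Ideal.sum_mem _ fun i _ => Ideal.mul_mem_right _ _ ?_)
        exact (IsLocalRing.mem_maximalIdeal _).2 (hb _ (Nat.succ_ne_zero i))
      exact (IsLocalRing.mem_maximalIdeal _).1 hmem hb0
    obtain ⟨c, hc⟩ : ∃ c : k, ∀ Q ∈ I, Q.eval c = 0 := by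
      obtain ⟨q, hq⟩ := (IsPrincipalIdealRing.principal I).principal
      have hq' : I = Ideal.span {q} := hq
      have hroot : ∃ c, q.eval c = 0 := by
        by_cases h0 : q = 0
        · exact ⟨0, by simp [h0]⟩
        · refine IsAlgClosed.exists_root q fun hdeg => hItop ?_
          rw [hq', Ideal.span_singleton_eq_top]
          exact isUnit_iff_degree_eq_zero.2 hdeg
      obtain ⟨c, hc⟩ := hroot
      refine ⟨c, fun Q hQ => ?_⟩
      rw [hq', Ideal.mem_span_singleton] at hQ
      obtain ⟨r, rfl⟩ := hQ
      simp [hc]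
    have hmem : ((x, c) : K × k) ∈ M := by
      refine mem_of_maximal_avoiding hM fun P hP => ?_
      have h1 : P.eval₂ f x = 0 := by
        have := congrArg (RingHom.fst K k) hP
        rw [aeval_def, hom_eval₂] at this
        exact this
      have h2 : P.eval₂ g c = 1 := by
        have := congrArg (RingHom.snd K k) hP
        rw [aeval_def, hom_eval₂] at this
        exact this
      have h3 := hc (P.map g) (Ideal.mem_map_of_mem (mapRingHom g) h1)
      rw [eval_map, h2] at h3
      exact one_ne_zero h3
    exact ⟨⟨_, hmem⟩, rfl⟩
  obtain ⟨O, hO⟩ := LocalSubring.exists_valuationRing_of_isMax hmax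
  have hO' : O.toSubring = f.range := congrArg LocalSubring.toSubring hO
  let i : O →+* f.range := Subring.inclusion hO'.le
  have hi : IsLocalHom i := by
    refine ⟨fun y hy => ?_⟩
    obtain ⟨z, hz⟩ := isUnit_iff_exists_inv.1 hy
    refine isUnit_iff_exists_inv.2 ⟨⟨z.1, hO'.ge z.2⟩, Subtype.ext ?_⟩
    have hz' : (y : K) * (z : K) = 1 := congrArg Subtype.val hz
    exact hz'
  refine ⟨O, φ.comp i, inferInstance, fun p hp => ?_⟩
  have hpM : p ∈ M := hAM hp
  refine ⟨hO'.ge (⟨⟨p, hpM⟩, rfl⟩ : p.1 ∈ f.range), ?_⟩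
  exact hφe ⟨p, hpM⟩

end Place

/-! ### Divisible groups and ordered groups -/

section Groups

/-- Gordan's alternative for finitely many elements of an abelian group: either some homomorphism to
`ℚ` is positive on all of them, or they satisfy a nontrivial relation with nonnegative
coefficients. -/
theorem exists_hom_pos_or_sum_eq_zero {ι : Type*} (s : Finset ι) {E : Type*} [AddCommGroup E]
    (a : ι → E) : (∃ f : E →+ ℚ, ∀ i ∈ s, 0 < f (a i)) ∨
      ∃ c : ι → ℕ, (∃ i ∈ s, c i ≠ 0) ∧ ∑ i ∈ s, c i • a i = 0 := by
  classical
  induction s using Finset.induction_on generalizing E with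
  | empty => exact Or.inl ⟨0, by simp⟩
  | insert j s hj ih =>
    -- It suffices to extend a relation on `s` by the coefficient `m` of `a j`.
    have hrel : ∀ (c : ι → ℕ) (m : ℕ), ((∃ i ∈ s, c i ≠ 0) ∨ m ≠ 0) →
        m • a j + ∑ i ∈ s, c i • a i = 0 →
        ∃ c : ι → ℕ, (∃ i ∈ insert j s, c i ≠ 0) ∧ ∑ i ∈ insert j s, c i • a i = 0 := by
      intro c m h hsum
      refine ⟨Function.update c j m, ?_, ?_⟩
      · rcases h with ⟨i, hi, hci⟩ | hm
        · refine ⟨i, Finset.mem_insert_of_mem hi, ?_⟩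
          rwa [Function.update_of_ne (by rintro rfl; exact hj hi)]
        · exact ⟨j, Finset.mem_insert_self _ _, by simpa using hm⟩
      · rw [Finset.sum_insert hj, Function.update_self, ← hsum]
        congr 1
        refine Finset.sum_congr rfl fun i hi => ?_
        rw [Function.update_of_ne (by rintro rfl; exact hj hi)]
    by_cases htor : ∃ m : ℕ, m ≠ 0 ∧ m • a j = 0
    · obtain ⟨m, hm, hma⟩ := htor
      exact Or.inr (hrel 0 m (Or.inr hm) (by simp [hma]))
    have hinj : Function.Injective (LinearMap.toSpanSingleton ℤ E (a j)) := by
      refine (injective_iff_map_eq_zero _).2 fun z hz => ?_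
      by_contra hz0
      refine htor ⟨z.natAbs, Int.natAbs_ne_zero.2 hz0, ?_⟩
      have hz' : z • a j = 0 := hz
      rcases Int.natAbs_eq z with h | h
      · rwa [h, natCast_zsmul] at hz'
      · rwa [h, neg_smul, neg_eq_zero, natCast_zsmul] at hz'
    rcases ih (E := E ⧸ AddSubgroup.zmultiples (a j)) (fun i => (a i : E ⧸ _)) with
      ⟨f, hf⟩ | ⟨c, hc, hsum⟩
    · obtain ⟨g, hg⟩ := (Module.Baer.of_divisible ℚ).extension_property _ hinj
        (Int.castAddHom ℚ).toIntLinearMap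
      have hga : g (a j) = 1 := by simpa using LinearMap.congr_fun hg 1
      -- A small multiple of `g` keeps `f` positive on `s`.
      obtain ⟨ε, hε, hεs⟩ : ∃ ε : ℚ, 0 < ε ∧ ∀ i ∈ s, 0 < f (a i) + ε * g (a i) := by
        clear ih hrel hj
        induction s using Finset.induction_on with
        | empty => exact ⟨1, one_pos, by simp⟩
        | insert l s _ ihs =>
          obtain ⟨ε, hε, hεs⟩ := ihs fun i hi => hf i (Finset.mem_insert_of_mem hi)
          have hl := hf l (Finset.mem_insert_self _ _)
          set y := g (a l)
          set δ := f (a l) / (2 * (|y| + 1))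
          have hy : 0 ≤ |y| := abs_nonneg y
          have hδ : 0 < δ := by positivity
          have hδy : δ * (|y| + 1) = f (a l) / 2 := by
            simp only [δ]
            field_simp
          refine ⟨min ε δ, lt_min hε hδ, fun i hi => ?_⟩
          rcases Finset.mem_insert.1 hi with rfl | hi
          · have h1 : min ε δ * |y| ≤ δ * |y| := mul_le_mul_of_nonneg_right (min_le_right _ _) hy
            have h2 : -(min ε δ * |y|) ≤ min ε δ * y := by
              rw [← mul_neg]
              exact mul_le_mul_of_nonneg_left (neg_abs_le y) (lt_min hε hδ).le
            nlinarith
          · have h1 := hεs i hi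
            have h2 := hf i (Finset.mem_insert_of_mem hi)
            rcases le_or_gt 0 (g (a i)) with h | h
            · have := mul_nonneg (lt_min hε hδ).le h
              linarith
            · have := mul_le_mul_of_nonpos_right (min_le_left ε δ) h.le
              linarith
      refine Or.inl ⟨f.comp (QuotientAddGroup.mk' _) + ε • g.toAddMonoidHom, fun i hi => ?_⟩
      rcases Finset.mem_insert.1 hi with rfl | hi
      · have : ((a i : E) : E ⧸ AddSubgroup.zmultiples (a i)) = 0 :=
          (QuotientAddGroup.eq_zero_iff _).2 (AddSubgroup.mem_zmultiples _)
        simp [this, hga, hε]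
      · simpa using hεs i hi
    · have hmem : ∑ i ∈ s, c i • a i ∈ AddSubgroup.zmultiples (a j) := by
        rw [← QuotientAddGroup.eq_zero_iff]
        simpa using hsum
      obtain ⟨z, hz⟩ := AddSubgroup.mem_zmultiples_iff.1 hmem
      rcases le_or_gt z 0 with h | h
      · obtain ⟨m, hm⟩ := Int.exists_eq_neg_ofNat h
        refine Or.inr (hrel c m (Or.inl hc) ?_)
        rw [← hz, hm, neg_smul, natCast_zsmul, add_neg_cancel]
      · rcases ih a with ⟨f, hf⟩ | ⟨c, hc, hsum⟩
        · refine Or.inl ⟨f, fun i hi => ?_⟩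
          rcases Finset.mem_insert.1 hi with rfl | hi
          · have h1 : 0 < ∑ l ∈ s, c l • f (a l) := by
              obtain ⟨l, hl, hcl⟩ := hc
              exact Finset.sum_pos' (fun l hl => nsmul_nonneg (hf l hl).le _)
                ⟨l, hl, nsmul_pos (hf l hl) hcl⟩
            have h2 : z • f (a i) = ∑ l ∈ s, c l • f (a l) := by
              rw [← map_zsmul, hz]
              simp
            rw [← h2, zsmul_eq_mul] at h1
            exact pos_of_mul_pos_right h1 (by exact_mod_cast h.le)
          · exact hf i hi
        · exact Or.inr (hrel c 0 (Or.inl hc) (by simpa using hsum))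

/-- Finitely many positive elements of an ordered abelian group, which may be of any rank, stay
positive under some homomorphism to `ℚ`. -/
theorem exists_hom_pos {ι Γ : Type*} [AddCommGroup Γ] [LinearOrder Γ] [IsOrderedAddMonoid Γ]
    (s : Finset ι) (a : ι → Γ) (ha : ∀ i ∈ s, 0 < a i) :
    ∃ f : Γ →+ ℚ, ∀ i ∈ s, 0 < f (a i) := by
  refine (exists_hom_pos_or_sum_eq_zero s a).resolve_right ?_
  rintro ⟨c, ⟨i, hi, hci⟩, hsum⟩
  exact (Finset.sum_pos' (fun l hl => nsmul_nonneg (ha l hl).le (c l))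
    ⟨i, hi, nsmul_pos (ha i hi) hci⟩).ne' hsum

/-- The value `∏ⱼ tⱼ ^ χⱼ * d ^ m` of the character `(χ, m)` at the point `(t, d)`, for a point
with coordinates in any commutative group. -/
def weightChar {k : ℕ} {H : Type*} [CommGroup H] (t : Fin k → H) (d : H)
    (P : (Fin k → ℤ) × ℤ) : H :=
  (∏ j, t j ^ P.1 j) * d ^ P.2

section WeightChar

variable {k : ℕ} {H H' : Type*} [CommGroup H] [CommGroup H'] (t : Fin k → H) (d : H)

theorem weightChar_zero : weightChar t d 0 = 1 := by simp [weightChar]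

theorem weightChar_add (P Q : (Fin k → ℤ) × ℤ) :
    weightChar t d (P + Q) = weightChar t d P * weightChar t d Q := by
  simp only [weightChar, Prod.fst_add, Prod.snd_add, Pi.add_apply, zpow_add,
    Finset.prod_mul_distrib]
  exact mul_mul_mul_comm _ _ _ _

theorem weightChar_zsmul (m : ℤ) (P : (Fin k → ℤ) × ℤ) :
    weightChar t d (m • P) = weightChar t d P ^ m := by
  simp [weightChar, mul_zpow, Finset.prod_zpow, zpow_mul, mul_comm m]

theorem weightChar_sum_zsmul {ι : Type*} (s : Finset ι) (β : ι → ℤ) (P : ι → (Fin k → ℤ) × ℤ) :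
    weightChar t d (∑ i ∈ s, β i • P i) = ∏ i ∈ s, weightChar t d (P i) ^ β i := by
  classical
  induction s using Finset.induction_on with
  | empty => simp [weightChar_zero]
  | insert i s hi ih =>
    rw [Finset.sum_insert hi, Finset.prod_insert hi, weightChar_add, weightChar_zsmul, ih]

theorem map_weightChar (f : H →* H') (P : (Fin k → ℤ) × ℤ) :
    f (weightChar t d P) = weightChar (fun j => f (t j)) (f d) P := by
  simp [weightChar, map_prod]

end WeightChar

/-- A torus over an algebraically closed field has a point at which finitely many characters take
prescribed values, provided that these values satisfy the relations between the characters. This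
holds because the group of units is divisible, hence injective. -/
theorem exists_weightChar_eq {F : Type*} [Field F] [IsAlgClosed F] {k : ℕ} {ι : Type*} [Fintype ι]
    (P : ι → (Fin k → ℤ) × ℤ) (c : ι → Fˣ)
    (hc : ∀ β : ι → ℤ, ∑ i, β i • P i = 0 → ∏ i, c i ^ β i = 1) :
    ∃ (t : Fin k → Fˣ) (d : Fˣ), ∀ i, weightChar t d (P i) = c i := by
  classical
  have hroot : ∀ {n : ℕ}, n ≠ 0 → Function.Surjective fun a : Additive Fˣ => n • a := by
    intro n hn a
    obtain ⟨z, hz⟩ := IsAlgClosed.exists_pow_nat_eq ((a.toMul : Fˣ) : F) (Nat.pos_of_ne_zero hn)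
    have hz0 : z ≠ 0 := by
      rintro rfl
      rw [zero_pow hn] at hz
      exact a.toMul.ne_zero hz.symm
    exact ⟨Additive.ofMul (Units.mk0 z hz0),
      congrArg Additive.ofMul (a₂ := a.toMul) (Units.ext (by simpa using hz))⟩
  let _ : DivisibleBy (Additive Fˣ) ℕ := divisibleByOfSMulRightSurj _ _ hroot
  let _ : DivisibleBy (Additive Fˣ) ℤ := AddGroup.divisibleByIntOfDivisibleByNat _
  let f : (ι → ℤ) →ₗ[ℤ] (Fin k → ℤ) × ℤ := Fintype.linearCombination ℤ P
  let g : (ι → ℤ) →ₗ[ℤ] Additive Fˣ :=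
    Fintype.linearCombination ℤ fun i => Additive.ofMul (c i)
  have hf : ∀ β, f β = ∑ i, β i • P i := fun β => Fintype.linearCombination_apply ℤ P β
  have hg : ∀ β, g β = ∑ i, β i • Additive.ofMul (c i) := fun β =>
    Fintype.linearCombination_apply ℤ _ β
  have hker : LinearMap.ker f ≤ LinearMap.ker g := by
    intro β hβ
    rw [LinearMap.mem_ker, hf] at hβ
    rw [LinearMap.mem_ker, hg]
    exact congrArg Additive.ofMul (hc β hβ)
  let q : (LinearMap.range f) →ₗ[ℤ] Additive Fˣ :=
    ((LinearMap.ker f).liftQ g hker).comp f.quotKerEquivRange.symm.toLinearMap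
  have hq : ∀ β, q ⟨f β, β, rfl⟩ = g β := by
    intro β
    have : f.quotKerEquivRange.symm ⟨f β, β, rfl⟩ = (LinearMap.ker f).mkQ β := by
      rw [LinearEquiv.symm_apply_eq]
      rfl
    show ((LinearMap.ker f).liftQ g hker) (f.quotKerEquivRange.symm ⟨f β, β, rfl⟩) = g β
    rw [this]
    rfl
  obtain ⟨h, hh⟩ := (Module.Baer.of_divisible (Additive Fˣ)).extension_property
    (LinearMap.range f).subtype Subtype.val_injective q
  refine ⟨fun j => (h (Pi.single j 1, 0)).toMul, (h (0, 1)).toMul, fun i => ?_⟩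
  have h1 : h (P i) = Additive.ofMul (c i) := by
    have h2 : f (Pi.single i 1) = P i := by simp [f]
    have h3 := LinearMap.congr_fun hh ⟨f (Pi.single i 1), _, rfl⟩
    rw [hq] at h3
    rw [← h2]
    refine h3.trans ?_
    simp [g]
  have h4 : P i = (∑ j, (P i).1 j • ((Pi.single j 1, 0) : (Fin k → ℤ) × ℤ)) +
      (P i).2 • ((0, 1) : (Fin k → ℤ) × ℤ) := by
    refine Prod.ext ?_ ?_
    · funext l
      simp [Prod.fst_sum, Finset.sum_apply, Pi.single_apply]
    · simp [Prod.snd_sum]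
  rw [h4, map_add, map_sum] at h1
  simp only [map_zsmul] at h1
  have h5 := congrArg Additive.toMul h1
  simpa [weightChar, toMul_sum] using h5

end Groups

/-! ### Binary forms over a commutative ring and their dehomogenizations -/

section Forms

open MvPolynomial

variable {R S : Type*} [CommRing R] [CommRing S]

/-- The linear substitution `f(x, y) ↦ f(κ x + μ y, λ x + ν y)` over any commutative ring. -/
noncomputable def linSubst (A : Matrix (Fin 2) (Fin 2) R) :
    MvPolynomial (Fin 2) R →ₐ[R] MvPolynomial (Fin 2) R :=
  aeval fun j => C (A 0 j) * X 0 + C (A 1 j) * X 1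

theorem linSubst_one : linSubst (1 : Matrix (Fin 2) (Fin 2) R) = AlgHom.id R _ := by
  ext j : 1
  fin_cases j <;> simp [linSubst]

theorem linSubst_mul (A B : Matrix (Fin 2) (Fin 2) R) :
    linSubst (A * B) = (linSubst A).comp (linSubst B) := by
  ext j : 1
  simp only [linSubst, aeval_X, AlgHom.comp_apply, map_add, map_mul,
    algHom_C, MvPolynomial.algebraMap_eq, Matrix.mul_apply, Fin.sum_univ_two]
  ring

theorem map_linSubst (φ : R →+* S) (A : Matrix (Fin 2) (Fin 2) R) (f : MvPolynomial (Fin 2) R) :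
    map φ (linSubst A f) = linSubst (A.map φ) (map φ f) := by
  induction f using MvPolynomial.induction_on with
  | C a => simp [linSubst]
  | add p q hp hq => simp [hp, hq]
  | mul_X p j hp =>
    rw [map_mul, map_mul, map_mul, map_mul, hp]
    congr 1
    simp [linSubst]

/-- The dehomogenization `f(x, y) ↦ f(1, X)`. -/
noncomputable def dehomog : MvPolynomial (Fin 2) R →ₐ[R] Polynomial R :=
  aeval ![1, Polynomial.X]

/-- The exponent of the monomial `x ^ (n - j) * y ^ j`. -/
noncomputable def expo (n j : ℕ) : Fin 2 →₀ ℕ := Finsupp.single 0 (n - j) + Finsupp.single 1 j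

theorem expo_zero (n j : ℕ) : expo n j 0 = n - j := by simp [expo]

theorem expo_one (n j : ℕ) : expo n j 1 = j := by simp [expo]

theorem eq_expo {n : ℕ} {m : Fin 2 →₀ ℕ} (hm : m.degree = n) : m = expo n (m 1) := by
  have : m 0 + m 1 = n := by rw [← hm, Finsupp.degree_eq_sum, Fin.sum_univ_two]
  ext i
  fin_cases i
  · simp [expo_zero]; omega
  · simp [expo_one]

theorem degree_expo {n j : ℕ} (hj : j ≤ n) : (expo n j).degree = n := by
  rw [Finsupp.degree_eq_sum, Fin.sum_univ_two, expo_zero, expo_one]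
  omega

theorem dehomog_monomial (m : Fin 2 →₀ ℕ) (c : R) :
    dehomog (monomial m c) = Polynomial.monomial (m 1) c := by
  simp [dehomog, aeval_monomial, Finsupp.prod_fintype, Polynomial.C_mul_X_pow_eq_monomial]

theorem dehomog_map (φ : R →+* S) (f : MvPolynomial (Fin 2) R) :
    dehomog (map φ f) = (dehomog f).map φ := by
  induction f using MvPolynomial.induction_on with
  | C a => simp [dehomog]
  | add p q hp hq => simp [hp, hq]
  | mul_X p j hp =>
    rw [map_mul, map_mul, hp, map_mul, Polynomial.map_mul]
    congr 1
    fin_cases j <;> simp [dehomog]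

/-- The binary form `∑ⱼ aⱼ x ^ (n - j) y ^ j`, where `aⱼ` are the coefficients of `F`. -/
noncomputable def homogForm (n : ℕ) (F : Polynomial R) : MvPolynomial (Fin 2) R :=
  ∑ j ∈ Finset.range (n + 1), monomial (expo n j) (F.coeff j)

theorem homogForm_isHomogeneous (n : ℕ) (F : Polynomial R) : (homogForm n F).IsHomogeneous n :=
  IsHomogeneous.sum _ _ _ fun _ hj => isHomogeneous_monomial _
    (degree_expo (Nat.lt_succ_iff.1 (Finset.mem_range.1 hj)))

theorem dehomog_homogForm {n : ℕ} {F : Polynomial R} (hF : F.natDegree ≤ n) :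
    dehomog (homogForm n F) = F := by
  rw [homogForm, map_sum]
  simp only [dehomog_monomial, expo_one]
  exact (F.as_sum_range' (n + 1) (Nat.lt_succ_of_le hF)).symm

theorem coeff_dehomog {n : ℕ} {f : MvPolynomial (Fin 2) R} (hf : f.IsHomogeneous n) {j : ℕ} :
    (dehomog f).coeff j = coeff (expo n j) f := by
  conv_lhs => rw [f.as_sum, map_sum, Polynomial.finsetSum_coeff]
  simp only [dehomog_monomial, Polynomial.coeff_monomial]
  rw [Finset.sum_eq_single (expo n j)]
  · rw [if_pos (expo_one n j)]
  · intro m hm hne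
    refine if_neg fun h => hne ?_
    rw [eq_expo (n := n) (m := m), h]
    rw [Finsupp.degree_eq_weight_one]
    exact hf (mem_support_iff.1 hm)
  · intro hm
    rw [if_pos (expo_one n j)]
    exact notMem_support_iff.1 hm

theorem natDegree_dehomog_le {n : ℕ} {f : MvPolynomial (Fin 2) R} (hf : f.IsHomogeneous n) :
    (dehomog f).natDegree ≤ n := by
  rw [f.as_sum, map_sum]
  refine Polynomial.natDegree_sum_le_of_forall_le _ _ fun m hm => ?_
  rw [dehomog_monomial]
  refine (Polynomial.natDegree_monomial_le _).trans ?_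
  have hd : m.degree = n := by
    rw [Finsupp.degree_eq_weight_one]
    exact hf (mem_support_iff.1 hm)
  rw [← hd, Finsupp.degree_eq_sum, Fin.sum_univ_two]
  omega

theorem dehomog_injective {n : ℕ} {f g : MvPolynomial (Fin 2) R} (hf : f.IsHomogeneous n)
    (hg : g.IsHomogeneous n) (h : dehomog f = dehomog g) : f = g := by
  ext m
  by_cases hm : m.degree = n
  · rw [eq_expo hm, ← coeff_dehomog hf, ← coeff_dehomog hg, h]
  · rw [hf.coeff_eq_zero hm, hg.coeff_eq_zero hm]

theorem homogForm_dehomog {n : ℕ} {f : MvPolynomial (Fin 2) R} (hf : f.IsHomogeneous n) :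
    homogForm n (dehomog f) = f :=
  dehomog_injective (homogForm_isHomogeneous _ _) hf (dehomog_homogForm (natDegree_dehomog_le hf))

/-- The action of an upper triangular matrix in terms of the dehomogenization. -/
theorem dehomog_linSubst {n : ℕ} {f : MvPolynomial (Fin 2) R} (hf : f.IsHomogeneous n)
    (p b r : R) : dehomog (linSubst !![p, p * b; 0, p * r] f) =
      Polynomial.C (p ^ n) * (dehomog f).comp (Polynomial.C b + Polynomial.C r * Polynomial.X) := by
  have h1 : dehomog (linSubst !![p, p * b; 0, p * r] f) = aeval
      ![Polynomial.C p, Polynomial.C p * (Polynomial.C b + Polynomial.C r * Polynomial.X)] f := by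
    have h2 : (dehomog (R := R)).comp (linSubst !![p, p * b; 0, p * r]) = aeval
        ![Polynomial.C p, Polynomial.C p * (Polynomial.C b + Polynomial.C r * Polynomial.X)] := by
      refine MvPolynomial.algHom_ext fun j => ?_
      fin_cases j
      · simp [linSubst, dehomog]
      · simp [linSubst, dehomog]
        ring
    exact AlgHom.congr_fun h2 f
  rw [h1]
  conv_lhs => rw [← homogForm_dehomog hf]
  rw [homogForm, map_sum, Polynomial.comp, Polynomial.eval₂_eq_sum_range'
    (n := n + 1) _ (Nat.lt_succ_of_le (natDegree_dehomog_le hf)), Finset.mul_sum]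
  refine Finset.sum_congr rfl fun j hj => ?_
  obtain ⟨i, rfl⟩ := Nat.exists_eq_add_of_le (Nat.lt_succ_iff.1 (Finset.mem_range.1 hj))
  rw [aeval_monomial, Finsupp.prod_fintype _ _ (fun _ => pow_zero _), Fin.prod_univ_two, expo_zero,
    expo_one]
  simp only [Matrix.cons_val_zero, Matrix.cons_val_one, Polynomial.algebraMap_eq,
    Nat.add_sub_cancel_left, mul_pow, pow_add, map_mul, map_pow]
  ring

end Forms

/-! ### Root multiplicities -/

section RootMult

open MvPolynomial

theorem pow_dvd_iff_dehomog {n : ℕ} (f : BinaryForm n) (a : ℂ) (e : ℕ) :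
    (C a * X 0 + X 1) ^ e ∣ (f : MvPolynomial (Fin 2) ℂ) ↔
      (Polynomial.X - Polynomial.C (-a)) ^ e ∣ dehomog (f : MvPolynomial (Fin 2) ℂ) := by
  have hlin : dehomog (C a * X 0 + X 1 : MvPolynomial (Fin 2) ℂ) =
      Polynomial.X - Polynomial.C (-a) := by
    simp [dehomog, add_comm]
  have hf : (f : MvPolynomial (Fin 2) ℂ).IsHomogeneous n := f.2
  constructor
  · intro h
    have := map_dvd dehomog h
    rwa [map_pow, hlin] at this
  · rintro ⟨G, hG⟩
    by_cases h0 : dehomog (f : MvPolynomial (Fin 2) ℂ) = 0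
    · have : (f : MvPolynomial (Fin 2) ℂ) = 0 :=
        dehomog_injective hf (isHomogeneous_zero _ _ _) (by rw [h0, map_zero])
      rw [this]
      exact dvd_zero _
    have hG0 : G ≠ 0 := by
      rintro rfl
      exact h0 (by rw [hG, mul_zero])
    have hdeg : e + G.natDegree ≤ n := by
      have h1 := natDegree_dehomog_le hf
      rw [hG, Polynomial.natDegree_mul (pow_ne_zero _ (Polynomial.X_sub_C_ne_zero _)) hG0,
        Polynomial.natDegree_pow, Polynomial.natDegree_X_sub_C, mul_one] at h1
      exact h1
    refine ⟨homogForm (n - e) G, dehomog_injective hf ?_ ?_⟩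
    · have h1 : (C a * X 0 + X 1 : MvPolynomial (Fin 2) ℂ).IsHomogeneous 1 :=
        (isHomogeneous_C_mul_X a 0).add (isHomogeneous_X _ 1)
      have h2 := (h1.pow e).mul (homogForm_isHomogeneous (n - e) G)
      rwa [one_mul, Nat.add_sub_cancel' (by omega)] at h2
    · rw [map_mul, map_pow, hlin, dehomog_homogForm (by omega), hG]

theorem rootMult_eq {n : ℕ} {f : BinaryForm n} (hf : f ≠ 0) (a : ℂ) :
    rootMult f a = (dehomog (f : MvPolynomial (Fin 2) ℂ)).rootMultiplicity (-a) := by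
  classical
  have h0 : dehomog (f : MvPolynomial (Fin 2) ℂ) ≠ 0 := fun h => hf (Subtype.ext
    (dehomog_injective (n := n) f.2 (isHomogeneous_zero _ _ _) (by simpa using h)))
  rw [Polynomial.rootMultiplicity_eq_multiplicity, if_neg h0, rootMult, multiplicity, multiplicity,
    emultiplicity_eq_emultiplicity_iff.2 fun e => pow_dvd_iff_dehomog f a e]

end RootMult

/-! ### Reduction of binary forms along a place -/

section Reduction

variable {K F : Type*} [Field K] [Field F] {O : ValuationSubring K}

/-- `Reduces φ p q` says that the form `p` over `K` has coefficients in the valuation ring `O` and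
that its reduction along `φ` is `q`. -/
def Reduces (φ : O →+* F) (p : MvPolynomial (Fin 2) K) (q : MvPolynomial (Fin 2) F) : Prop :=
  ∃ h : MvPolynomial (Fin 2) O, h.map O.subtype = p ∧ h.map φ = q

theorem reduces_of_coeff {φ : O →+* F} {p : MvPolynomial (Fin 2) K} {q : MvPolynomial (Fin 2) F}
    (h : ∀ m, ∃ hm : p.coeff m ∈ O, φ ⟨p.coeff m, hm⟩ = q.coeff m) : Reduces φ p q := by
  have hp : p ∈ Set.range (MvPolynomial.map O.subtype) := by
    rw [MvPolynomial.mem_range_map_iff_coeffs_subset]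
    intro c hc
    obtain ⟨m, _, rfl⟩ := MvPolynomial.mem_coeffs_iff.1 hc
    exact ⟨⟨_, (h m).1⟩, rfl⟩
  obtain ⟨f, hf⟩ := hp
  refine ⟨f, hf, ?_⟩
  ext m
  obtain ⟨hm, hm'⟩ := h m
  rw [MvPolynomial.coeff_map, ← hm']
  congr 1
  refine Subtype.ext ?_
  exact (MvPolynomial.coeff_map O.subtype f m).symm.trans (by rw [hf])

theorem Reduces.linSubst {φ : O →+* F} {p : MvPolynomial (Fin 2) K} {q : MvPolynomial (Fin 2) F}
    (h : Reduces φ p q) (Q : Matrix (Fin 2) (Fin 2) O) :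
    Reduces φ (linSubst (Q.map O.subtype) p) (TorusSL2.linSubst (Q.map φ) q) := by
  obtain ⟨f, rfl, rfl⟩ := h
  exact ⟨TorusSL2.linSubst Q f, map_linSubst _ _ _, map_linSubst _ _ _⟩

theorem Reduces.dehomog {φ : O →+* F} {p : MvPolynomial (Fin 2) K} {q : MvPolynomial (Fin 2) F}
    (h : Reduces φ p q) : ∃ H : Polynomial O,
      H.map O.subtype = TorusSL2.dehomog p ∧ H.map φ = TorusSL2.dehomog q := by
  obtain ⟨f, rfl, rfl⟩ := h
  exact ⟨TorusSL2.dehomog f, (dehomog_map _ _).symm, (dehomog_map _ _).symm⟩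

/-- If `H` is a polynomial over `O` with nonzero reduction and `s * H` has coefficients in `O`, then `s ∈ O`. -/
theorem exists_scalar_of_map_eq (φ : O →+* F) [IsLocalHom φ] {H H' : Polynomial O} {s : K}
    (h : H'.map O.subtype = Polynomial.C s * H.map O.subtype) (h0 : H.map φ ≠ 0) :
    ∃ s' : O, (s' : K) = s ∧ H'.map φ = Polynomial.C (φ s') * H.map φ := by
  obtain ⟨m, hm⟩ : ∃ m, (H.map φ).coeff m ≠ 0 := by
    by_contra! hall
    exact h0 (Polynomial.ext fun m => by simpa using hall m)
  rw [Polynomial.coeff_map] at hm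
  have hu : IsUnit (H.coeff m) := IsUnit.of_map φ _ hm.isUnit
  obtain ⟨z, hz⟩ := isUnit_iff_exists_inv.1 hu
  have hz' : (H.coeff m : K) * z = 1 := congrArg Subtype.val hz
  have hs : ((H'.coeff m * z : O) : K) = s := by
    have := congrArg (fun P => P.coeff m) h
    simp only [Polynomial.coeff_map, Polynomial.coeff_C_mul] at this
    have h2 : (H'.coeff m : K) = s * (H.coeff m : K) := this
    rw [MulMemClass.coe_mul, h2, mul_assoc, hz', mul_one]
  refine ⟨H'.coeff m * z, hs, ?_⟩
  have : H' = Polynomial.C (H'.coeff m * z) * H := by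
    apply Polynomial.map_injective O.subtype Subtype.val_injective
    rw [h, Polynomial.map_mul, Polynomial.map_C]
    congr 2
    exact hs.symm
  conv_lhs => rw [this, Polynomial.map_mul, Polynomial.map_C]

/-- Multiplicative relations between units of the valuation ring are inherited by their residues. -/
theorem prod_residue_eq_one (φ : O →+* F) {ι : Type*} [Fintype ι] {x : ι → Kˣ} {c : ι → Fˣ}
    (h : ∀ i, ∃ y : O, (y : K) = x i ∧ φ y = c i) [IsLocalHom φ] {β : ι → ℤ}
    (hx : ∏ i, x i ^ β i = 1) : ∏ i, c i ^ β i = 1 := by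
  have h' : ∀ i, ∃ y : Oˣ, Units.map O.subtype y = x i ∧ Units.map φ y = c i := by
    intro i
    obtain ⟨y, hy, hyc⟩ := h i
    have hu : IsUnit y := IsUnit.of_map φ _ (hyc ▸ (c i).isUnit)
    exact ⟨hu.unit, Units.ext hy, Units.ext hyc⟩
  choose y hyx hyc using h'
  have hy : ∏ i, y i ^ β i = 1 := by
    apply Units.map_injective (f := (O.subtype : O →* K)) Subtype.val_injective
    rw [map_prod, map_one, ← hx]
    exact Finset.prod_congr rfl fun i _ => by rw [map_zpow]; exact congrArg (· ^ β i) (hyx i)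
  have := congrArg (Units.map (φ : O →* F)) hy
  rw [map_prod, map_one] at this
  rw [← this]
  exact Finset.prod_congr rfl fun i _ => by rw [map_zpow]; exact congrArg (· ^ β i) (hyc i).symm

/-- The Weyl element of `SL₂`. -/
def weyl (F : Type*) [CommRing F] : Matrix.SpecialLinearGroup (Fin 2) F :=
  ⟨!![0, 1; -1, 0], by simp [Matrix.det_fin_two]⟩

/-- The upper unipotent matrix with entry `b`. -/
def unip {F : Type*} [CommRing F] (b : F) : Matrix.SpecialLinearGroup (Fin 2) F :=
  ⟨!![1, b; 0, 1], by simp [Matrix.det_fin_two]⟩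

/-- The diagonal matrix with entries `d` and `d⁻¹`. -/
def diagTorus {F : Type*} [CommRing F] (d : Fˣ) : Matrix.SpecialLinearGroup (Fin 2) F :=
  ⟨!![(d : F), 0; 0, ((d⁻¹ : Fˣ) : F)], by simp [Matrix.det_fin_two]⟩

/-- The case of `exists_cartan` in which the top row of `A` has maximal valuation. -/
theorem exists_cartan_of_row (φ : O →+* F) [IsLocalHom φ] (j : F →+* O) (hj : ∀ c, φ (j c) = c)
    (a b c e : K) (hdet : a * e - b * c = 1)
    (hmax : ∃ m, (m = a ∨ m = b) ∧ m ≠ 0 ∧ a / m ∈ O ∧ b / m ∈ O ∧ c / m ∈ O ∧ e / m ∈ O) :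
    ∃ (Q : Matrix.SpecialLinearGroup (Fin 2) O) (d b' : K) (β : F)
      (g : Matrix.SpecialLinearGroup (Fin 2) F),
      (g = 1 ∨ g = weyl F ∧ β = 0) ∧ d ≠ 0 ∧ d⁻¹ ∈ O ∧ (∃ h : b' ∈ O, φ ⟨b', h⟩ = 0) ∧
      Q.1.map O.subtype * !![a, b; c, e] =
        !![d, d * b'; 0, d⁻¹] * (unip β * g).1.map (O.subtype.comp j) := by
  obtain ⟨m, hm, hm0, ha, hb, hc, he⟩ := hmax
  have hinv : m⁻¹ ∈ O := by
    rcases O.mem_or_inv_mem m with h | h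
    · have h1 : m⁻¹ = m * (a / m * (e / m) - b / m * (c / m)) := by
        field_simp
        linear_combination -hdet
      rw [h1]
      exact O.mul_mem _ _ h (sub_mem (O.mul_mem _ _ ha he) (O.mul_mem _ _ hb hc))
    · exact h
  by_cases h1 : ∃ h : a ≠ 0, b / a ∈ O ∧ c / a ∈ O ∧ a⁻¹ ∈ O
  · obtain ⟨ha0, hba, hca, hainv⟩ := h1
    set y : O := ⟨b / a, hba⟩
    refine ⟨⟨!![1, 0; -⟨c / a, hca⟩, 1], by simp [Matrix.det_fin_two]⟩, a, b / a - j (φ y), φ y, 1,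
      Or.inl rfl, ha0, hainv, ⟨sub_mem hba (j (φ y)).2, ?_⟩, ?_⟩
    · have : (⟨b / a - j (φ y), sub_mem hba (j (φ y)).2⟩ : O) = y - j (φ y) := rfl
      rw [this, map_sub, hj, sub_self]
    · have hM : (unip (φ y) * 1).1.map (O.subtype.comp j) = !![1, (j (φ y) : K); 0, 1] := by
        rw [mul_one]
        ext p q
        fin_cases p <;> fin_cases q <;> simp [unip]
      rw [hM]
      ext p q
      fin_cases p <;> fin_cases q <;> simp [Matrix.mul_apply, Fin.sum_univ_two]
      · field_simp
        ring
      · field_simp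
        ring
      · field_simp
        linear_combination hdet
  · obtain rfl | rfl := hm
    · exact absurd ⟨hm0, hb, hc, hinv⟩ h1
    · have hres : φ ⟨a / m, ha⟩ = 0 := by
        by_contra h0
        have hu : IsUnit (⟨a / m, ha⟩ : O) := IsUnit.of_map φ _ (Ne.isUnit h0)
        obtain ⟨z, hz⟩ := isUnit_iff_exists_inv.1 hu
        have hz' : a / m * z = 1 := congrArg Subtype.val hz
        have ha0 : a ≠ 0 := by
          rintro rfl
          simp at hz'
        have hma : m / a = z := by
          field_simp at hz' ⊢
          exact hz'.symm
        refine h1 ⟨ha0, hma ▸ z.2, ?_, ?_⟩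
        · have : c / a = c / m * z := by rw [← hma]; field_simp
          rw [this]
          exact O.mul_mem _ _ hc z.2
        · have : a⁻¹ = m⁻¹ * z := by rw [← hma]; field_simp
          rw [this]
          exact O.mul_mem _ _ hinv z.2
      refine ⟨⟨!![1, 0; -⟨e / m, he⟩, 1], by simp [Matrix.det_fin_two]⟩, m, -(a / m), 0, weyl F,
        Or.inr ⟨rfl, rfl⟩, hm0, hinv, ⟨O.neg_mem _ ha, ?_⟩, ?_⟩
      · have : (⟨-(a / m), O.neg_mem _ ha⟩ : O) = -⟨a / m, ha⟩ := rfl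
        rw [this, map_neg, hres, neg_zero]
      · have hM : (unip 0 * weyl F).1.map (O.subtype.comp j) = !![0, 1; -1, 0] := by
          rw [Matrix.SpecialLinearGroup.coe_mul, Matrix.map_mul]
          ext p q
          fin_cases p <;> fin_cases q <;> simp [Matrix.mul_apply, Fin.sum_univ_two, unip, weyl]
        rw [hM]
        ext p q
        fin_cases p <;> fin_cases q <;> simp [Matrix.mul_apply, Fin.sum_univ_two]
        · field_simp
        · field_simp
          linear_combination -hdet
        · field_simp
          ring

theorem exists_max_entry (O : ValuationSubring K) {ι : Type*} [Fintype ι] (f : ι → K)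
    (hf : ∃ i, f i ≠ 0) : ∃ i, f i ≠ 0 ∧ ∀ l, f l / f i ∈ O := by
  obtain ⟨i₀, hi₀⟩ := hf
  have : Nonempty ι := ⟨i₀⟩
  obtain ⟨i, hi⟩ := Finite.exists_max fun i => O.valuation (f i)
  have hi0 : f i ≠ 0 := by
    intro h
    have := hi i₀
    rw [h, map_zero, le_zero_iff, map_eq_zero] at this
    exact hi₀ this
  refine ⟨i, hi0, fun l => ?_⟩
  rw [← O.valuation_le_one_iff, map_div₀]
  exact div_le_one_of_le₀ (hi l) zero_le

/-- The Cartan decomposition `SL₂(K) = SL₂(O) T(K) SL₂(O)`. The right factor is refined: it is the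
product of a unipotent matrix whose entry `b` reduces to zero and of a matrix `unip β * g` over `F`,
where `g` is trivial or the Weyl element. -/
theorem exists_cartan (φ : O →+* F) [IsLocalHom φ] (j : F →+* O) (hj : ∀ c, φ (j c) = c)
    (A : Matrix (Fin 2) (Fin 2) K) (hA : A.det = 1) :
    ∃ (Q : Matrix.SpecialLinearGroup (Fin 2) O) (d b : K) (β : F)
      (g : Matrix.SpecialLinearGroup (Fin 2) F),
      (g = 1 ∨ g = weyl F ∧ β = 0) ∧ d ≠ 0 ∧ d⁻¹ ∈ O ∧ (∃ h : b ∈ O, φ ⟨b, h⟩ = 0) ∧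
      Q.1.map O.subtype * A =
        !![d, d * b; 0, d⁻¹] * (unip β * g).1.map (O.subtype.comp j) := by
  rw [Matrix.det_fin_two] at hA
  obtain ⟨⟨p, q⟩, hpq, hmax⟩ := exists_max_entry O (fun i : Fin 2 × Fin 2 => A i.1 i.2) (by
    by_contra! h
    have h1 := h (0, 0)
    have h2 := h (0, 1)
    simp only at h1 h2
    rw [h1, h2] at hA
    simp at hA)
  have h00 := hmax (0, 0)
  have h01 := hmax (0, 1)
  have h10 := hmax (1, 0)
  have h11 := hmax (1, 1)
  simp only at h00 h01 h10 h11 hpq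
  have hq : A p q = A p 0 ∨ A p q = A p 1 := by fin_cases q <;> simp
  fin_cases p
  · obtain ⟨Q, d, b, β, g, hg, hd, hd', hb, h⟩ := exists_cartan_of_row φ j hj _ _ _ _ hA
      ⟨_, hq, hpq, h00, h01, h10, h11⟩
    refine ⟨Q, d, b, β, g, hg, hd, hd', hb, ?_⟩
    rw [← h]
    congr 1
    exact Matrix.eta_fin_two A
  · have hneg : ∀ {x : K}, x ∈ O → -x ∈ O := fun hx => O.neg_mem _ hx
    obtain ⟨Q, d, b, β, g, hg, hd, hd', hb, h⟩ := exists_cartan_of_row φ j hj (A 1 0) (A 1 1)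
      (-A 0 0) (-A 0 1) (by linear_combination hA)
      ⟨_, hq, hpq, h10, h11, by rw [neg_div]; exact hneg h00, by rw [neg_div]; exact hneg h01⟩
    refine ⟨Q * weyl O, d, b, β, g, hg, hd, hd', hb, ?_⟩
    rw [← h]
    have h1 : (Q * weyl O).1.map O.subtype = Q.1.map O.subtype * !![0, 1; -1, 0] := by
      rw [Matrix.SpecialLinearGroup.coe_mul, Matrix.map_mul]
      congr 1
      ext p q
      fin_cases p <;> fin_cases q <;> simp [weyl]
    rw [h1, Matrix.mul_assoc]
    congr 1
    ext p q
    fin_cases p <;> fin_cases q <;> simp [Matrix.mul_apply, Fin.sum_univ_two]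

end Reduction

/-! ### The generic point of an orbit closure -/

section GenericPoint

open Filter

/-- The sets where finitely many polynomial functions, all nonzero at `w`, do not vanish have the
finite intersection property. -/
theorem exists_ultrafilter_of_mem_zariskiClosure {V X : Type*} [AddCommGroup V] [Module ℂ V]
    (γ : X → V) {w : V} (hw : w ∈ zariskiClosure (Set.range γ)) :
    ∃ 𝒰 : Ultrafilter X, ∀ f ∈ polyFun V, f w ≠ 0 → ∀ᶠ g in 𝒰, f (γ g) ≠ 0 := by
  classical
  obtain ⟨𝒰, h𝒰⟩ := Ultrafilter.exists_ultrafilter_of_finite_inter_nonempty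
    {U : Set X | ∃ f ∈ polyFun V, f w ≠ 0 ∧ U = {g | f (γ g) ≠ 0}} (by
      intro T hT
      choose! f hf hfw hU using fun U (hU : U ∈ T) => hT hU
      by_contra hempty
      have hprod : ∏ U ∈ T, f U ∈ polyFun V := Subalgebra.prod_mem _ hf
      refine Finset.prod_ne_zero_iff.2 hfw ?_
      rw [← Finset.prod_apply]
      refine hw _ hprod ?_
      rintro _ ⟨g, rfl⟩
      by_contra hne
      rw [Finset.prod_apply, ← ne_eq, Finset.prod_ne_zero_iff] at hne
      refine hempty ⟨g, fun U hUT => ?_⟩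
      rw [hU U hUT]
      exact hne U hUT)
  exact ⟨𝒰, fun f hf hfw => h𝒰 ⟨f, hf, hfw, rfl⟩⟩

/-- A point `w` of the Zariski closure of the image of `γ` is the specialization of the tautological
point `γ` over an ultrapower of `ℂ`. -/
theorem exists_place_of_mem_zariskiClosure {V X : Type} [AddCommGroup V] [Module ℂ V]
    (γ : X → V) {w : V} (hw : w ∈ zariskiClosure (Set.range γ)) :
    ∃ (K : Type) (_ : Field K) (π : (X → ℂ) →+* K) (O : ValuationSubring K) (φ : O →+* ℂ)
      (j : ℂ →+* O), IsLocalHom φ ∧ (∀ c, φ (j c) = c) ∧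
      (O.subtype.comp j = π.comp (Pi.constRingHom X ℂ)) ∧
      ∀ f : Module.Dual ℂ V, ∃ h : π (fun g => f (γ g)) ∈ O, φ ⟨_, h⟩ = f w := by
  obtain ⟨𝒰, h𝒰⟩ := exists_ultrafilter_of_mem_zariskiClosure γ hw
  let K := Germ (𝒰 : Filter X) ℂ
  let π : (X → ℂ) →+* K := Germ.coeRingHom _
  let _ : Algebra ℂ K := (π.comp (Pi.constRingHom X ℂ)).toAlgebra
  let Ψ₁ : polyFun V →ₐ[ℂ] K :=
    { toFun := fun f => π fun g => f.1 (γ g)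
      map_one' := π.map_one
      map_mul' := fun f g => π.map_mul _ _
      map_zero' := π.map_zero
      map_add' := fun f g => π.map_add _ _
      commutes' := fun c => rfl }
  let Ψ₂ : polyFun V →ₐ[ℂ] ℂ :=
    { toFun := fun f => f.1 w
      map_one' := rfl
      map_mul' := fun f g => rfl
      map_zero' := rfl
      map_add' := fun f g => rfl
      commutes' := fun c => rfl }
  let Ψ : polyFun V →ₐ[ℂ] K × ℂ := Ψ₁.prod Ψ₂
  have h01 : ((0 : K), (1 : ℂ)) ∉ Ψ.range := by
    rintro ⟨f, hf⟩
    have h1 : π (fun g => f.1 (γ g)) = 0 := congrArg Prod.fst hf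
    have h2 : f.1 w = 1 := congrArg Prod.snd hf
    have h3 := h𝒰 f.1 f.2 (by rw [h2]; exact one_ne_zero)
    have h4 : (fun g => f.1 (γ g)) =ᶠ[(𝒰 : Filter X)] fun _ => 0 := Germ.coe_eq.1 h1
    obtain ⟨g, hg, hg'⟩ := (h3.and h4).exists
    exact hg hg'
  obtain ⟨O, φ, hφ, hO⟩ := exists_place Ψ.range h01
  have hconst : ∀ c, ∃ h : algebraMap ℂ K c ∈ O, φ ⟨_, h⟩ = c := fun c =>
    hO (algebraMap ℂ K c, c) ⟨algebraMap ℂ _ c, rfl⟩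
  let j : ℂ →+* O := (algebraMap ℂ K).codRestrict O.toSubring fun c => (hconst c).1
  refine ⟨K, inferInstance, π, O, φ, j, hφ, fun c => (hconst c).2, rfl, fun f => ?_⟩
  exact hO (π fun g => f (γ g), f w) ⟨⟨f, Algebra.subset_adjoin ⟨f, rfl⟩⟩, rfl⟩

variable {k s : ℕ} {χ : Fin s → Fin k → ℤ} {n : Fin s → ℕ}

theorem character_eq_weightChar (χ : Fin k → ℤ) (t : Fin k → ℂˣ) (d : ℂˣ) :
    character χ t = weightChar t d (χ, 0) := by
  simp [character, weightChar]

theorem coe_rep (g : Grp k) (w : Space n) (i : Fin s) :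
    (rep χ n g w i : MvPolynomial (Fin 2) ℂ) =
      MvPolynomial.C ((character (χ i) g.1 : ℂˣ) : ℂ) * linSubst g.2.1 (w i).1 := by
  rw [← MvPolynomial.smul_eq_C_mul]
  rfl

/-- A point of the Zariski closure of an orbit is the reduction of a point of the orbit over a
valued field. -/
theorem exists_reduction {v w : Space n} (hw : w ∈ zariskiClosure (orbit χ n v)) :
    ∃ (K : Type) (_ : Field K) (O : ValuationSubring K) (φ : O →+* ℂ) (j : ℂ →+* O)
      (t : Fin k → Kˣ) (A : Matrix (Fin 2) (Fin 2) K), IsLocalHom φ ∧ (∀ c, φ (j c) = c) ∧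
      A.det = 1 ∧ ∀ i, Reduces φ (MvPolynomial.C ((weightChar t 1 (χ i, 0) : Kˣ) : K) *
        linSubst A ((v i).1.map (O.subtype.comp j))) (w i).1 := by
  obtain ⟨K, _, π, O, φ, j, hφ, hj, hπ, hf⟩ :=
    exists_place_of_mem_zariskiClosure (fun g : Grp k => rep χ n g v) hw
  -- the tautological point of the group over the ring of all functions on the group
  let τ : Fin k → (Grp k → ℂ)ˣ := fun l =>
    ⟨fun g => (g.1 l : ℂ), fun g => ((g.1 l)⁻¹ : ℂˣ), by ext; simp, by ext; simp⟩
  let B : Matrix (Fin 2) (Fin 2) (Grp k → ℂ) := fun p q g => g.2.1 p q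
  have hB : B.det = 1 := by
    funext g
    have : g.2.1.det = 1 := g.2.2
    rw [Matrix.det_fin_two] at this ⊢
    exact this
  refine ⟨K, inferInstance, O, φ, j, fun l => Units.map π (τ l), B.map π, hφ, hj, ?_, fun i => ?_⟩
  · have := π.map_det B
    rw [hB, map_one] at this
    exact this.symm
  · let P : MvPolynomial (Fin 2) (Grp k → ℂ) :=
      MvPolynomial.C ((weightChar τ 1 (χ i, 0) : (Grp k → ℂ)ˣ) : Grp k → ℂ) *
        linSubst B ((v i).1.map (Pi.constRingHom (Grp k) ℂ))
    have hP : MvPolynomial.C ((weightChar (fun l => Units.map (π : (Grp k → ℂ) →* K) (τ l)) 1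
        (χ i, 0) : Kˣ) : K) * linSubst (B.map π) ((v i).1.map (O.subtype.comp j)) = P.map π := by
      rw [hπ, map_mul, MvPolynomial.map_C, map_linSubst, MvPolynomial.map_map]
      congr 2
      have := map_weightChar τ 1 (Units.map (π : (Grp k → ℂ) →* K)) (χ i, 0)
      rw [map_one] at this
      rw [← this]
      rfl
    have hPg : ∀ g, P.map (Pi.evalRingHom (fun _ => ℂ) g) = (rep χ n g v i).1 := by
      intro g
      rw [coe_rep, map_mul, MvPolynomial.map_C, map_linSubst, MvPolynomial.map_map]
      have h1 : (Pi.evalRingHom (fun _ : Grp k => ℂ) g).comp (Pi.constRingHom (Grp k) ℂ) =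
        RingHom.id ℂ := rfl
      rw [h1, MvPolynomial.map_id]
      congr 2
      have := map_weightChar τ 1
        (Units.map (Pi.evalRingHom (fun _ : Grp k => ℂ) g : (Grp k → ℂ) →* ℂ)) (χ i, 0)
      rw [map_one] at this
      rw [character_eq_weightChar (χ i) g.1 1]
      refine (congrArg Units.val this).trans ?_
      congr 2
    rw [hP]
    refine reduces_of_coeff fun m => ?_
    let f : Module.Dual ℂ (Space n) := (MvPolynomial.lcoeff ℂ m).comp
      ((Submodule.subtype _).comp (LinearMap.proj i))
    have hfm : (fun g => f (rep χ n g v)) = P.coeff m := by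
      funext g
      have h1 : f (rep χ n g v) = (rep χ n g v i).1.coeff m := rfl
      rw [h1, ← hPg, MvPolynomial.coeff_map]
      rfl
    have := hf f
    rw [hfm, show f w = (w i).1.coeff m from rfl] at this
    simpa only [MvPolynomial.coeff_map] using this

end GenericPoint

/-! ### Orbits -/

section Orbits

variable {k s : ℕ} {χ : Fin s → Fin k → ℤ} {n : Fin s → ℕ}

theorem mem_orbit_self (w : Space n) : w ∈ orbit χ n w :=
  ⟨1, by simp⟩

theorem mem_orbit_trans {u v w : Space n} (h₁ : u ∈ orbit χ n v) (h₂ : v ∈ orbit χ n w) :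
    u ∈ orbit χ n w := by
  obtain ⟨g, rfl⟩ := h₁
  obtain ⟨h, rfl⟩ := h₂
  exact ⟨g * h, by simp⟩

theorem mem_orbit_symm {u v : Space n} (h : u ∈ orbit χ n v) : v ∈ orbit χ n u := by
  obtain ⟨g, rfl⟩ := h
  refine ⟨g⁻¹, ?_⟩
  show rep χ n g⁻¹ (rep χ n g v) = v
  rw [← Module.End.mul_apply, ← map_mul, inv_mul_cancel, map_one, Module.End.one_apply]

theorem orbit_eq_of_mem {u v : Space n} (h : u ∈ orbit χ n v) : orbit χ n u = orbit χ n v :=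
  Set.Subset.antisymm (fun _ hx => mem_orbit_trans hx h)
    fun _ hx => mem_orbit_trans hx (mem_orbit_symm h)

theorem rep_mem_orbit (g : Grp k) (w : Space n) : rep χ n g w ∈ orbit χ n w := ⟨g, rfl⟩

/-- The binary form of degree `m` whose dehomogenization is the truncation of `F`. -/
noncomputable def ofPoly (m : ℕ) (F : Polynomial ℂ) : BinaryForm m :=
  ⟨homogForm m F, homogForm_isHomogeneous m F⟩

theorem ext_dehomog {m : ℕ} {f g : BinaryForm m} (h : dehomog f.1 = dehomog g.1) : f = g :=
  Subtype.ext (dehomog_injective f.2 g.2 h)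

theorem dehomog_ne_zero {m : ℕ} {f : BinaryForm m} (h : f ≠ 0) : dehomog f.1 ≠ 0 := fun h0 =>
  h (ext_dehomog (by simpa using h0))

theorem dehomog_ofPoly {m : ℕ} {F : Polynomial ℂ} (hF : F.natDegree ≤ m) :
    dehomog (ofPoly m F).1 = F :=
  dehomog_homogForm hF

theorem coeff_dehomog_eq_zero {m : ℕ} (f : BinaryForm m) {l : ℕ} (hl : m < l) :
    (dehomog f.1).coeff l = 0 :=
  Polynomial.coeff_eq_zero_of_natDegree_lt ((natDegree_dehomog_le f.2).trans_lt hl)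

theorem coeff_rep_diagTorus (t : Fin k → ℂˣ) (d : ℂˣ) (w : Space n) (i : Fin s) (l : ℕ) :
    (dehomog (rep χ n (t, diagTorus d) w i).1).coeff l =
      (weightChar t d (χ i, (n i : ℤ) - 2 * l) : ℂˣ) * (dehomog (w i).1).coeff l := by
  have hM : (diagTorus d).1 = !![(d : ℂ), d * 0; 0, d * (((d⁻¹ : ℂˣ) : ℂ) ^ 2)] := by
    have : (d : ℂ) * (((d⁻¹ : ℂˣ) : ℂ) ^ 2) = (d⁻¹ : ℂˣ) := by
      rw [pow_two, ← mul_assoc, Units.mul_inv, one_mul]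
    rw [this, mul_zero]
    rfl
  rw [coe_rep, map_mul, hM, dehomog_linSubst (w i).2, map_zero, zero_add,
    character_eq_weightChar (χ i) t d]
  have hC : dehomog (MvPolynomial.C ((weightChar t d (χ i, 0) : ℂˣ) : ℂ)) =
      Polynomial.C ((weightChar t d (χ i, 0) : ℂˣ) : ℂ) := by simp [dehomog]
  rw [hC, Polynomial.coeff_C_mul, Polynomial.coeff_C_mul, Polynomial.comp_C_mul_X_coeff]
  have : weightChar t d (χ i, (n i : ℤ) - 2 * l) =
      weightChar t d (χ i, 0) * d ^ n i * (d⁻¹ ^ 2) ^ l := by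
    simp only [weightChar, zpow_sub, zpow_mul, zpow_natCast, zpow_zero, mul_one, inv_pow]
    rw [mul_assoc]
    congr 2
  rw [this]
  push_cast
  ring

/-- A vector obtained from `w₀` by scaling its coefficients lies in the orbit of `w₀`, if the
scaling factors satisfy all the multiplicative relations between the weights of the torus
`(t, diag(d, d⁻¹))`. -/
theorem mem_orbit_of_coeff {w w₀ : Space n} (c : Fin s → ℕ → ℂ)
    (hc : ∀ i l, (dehomog (w i).1).coeff l = c i l * (dehomog (w₀ i).1).coeff l)
    (hc0 : ∀ i l, (dehomog (w₀ i).1).coeff l ≠ 0 → c i l ≠ 0)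
    (hrel : ∀ β : {p : Σ i, Fin (n i + 1) // (dehomog (w₀ p.1).1).coeff p.2 ≠ 0} → ℤ,
      ∑ p, β p • ((χ p.1.1, (n p.1.1 : ℤ) - 2 * (p.1.2 : ℕ)) : (Fin k → ℤ) × ℤ) = 0 →
        ∏ p, c p.1.1 p.1.2 ^ β p = 1) :
    w ∈ orbit χ n w₀ := by
  obtain ⟨t, d, htd⟩ := exists_weightChar_eq
    (fun p : {p : Σ i, Fin (n i + 1) // (dehomog (w₀ p.1).1).coeff p.2 ≠ 0} =>
      ((χ p.1.1, (n p.1.1 : ℤ) - 2 * (p.1.2 : ℕ)) : (Fin k → ℤ) × ℤ))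
    (fun p => Units.mk0 (c p.1.1 p.1.2) (hc0 _ _ p.2)) (by
      intro β hβ
      refine Units.ext ?_
      simpa using hrel β hβ)
  refine ⟨(t, diagTorus d), funext fun i => ext_dehomog (Polynomial.ext fun l => ?_)⟩
  show (dehomog (rep χ n (t, diagTorus d) w₀ i).1).coeff l = _
  rw [coeff_rep_diagTorus, hc]
  by_cases h0 : (dehomog (w₀ i).1).coeff l = 0
  · rw [h0, mul_zero, mul_zero]
  · have hl : l < n i + 1 := by
      by_contra hl
      exact h0 (coeff_dehomog_eq_zero _ (by omega))
    have := congrArg Units.val (htd ⟨⟨i, ⟨l, hl⟩⟩, h0⟩)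
    simp only [Units.val_mk0] at this
    rw [this]

/-- The vector with the components of `u` outside `J` replaced by zero. -/
noncomputable def restrict (J : Finset (Fin s)) (u : Space n) : Space n :=
  fun i => if i ∈ J then u i else 0

/-- The vector whose components are the sums of the terms of `u i` with the exponents of `y`
in `J i`. -/
noncomputable def selectTerms (J : ∀ i, Finset (Fin (n i + 1))) (u : Space n) : Space n :=
  fun i => ofPoly (n i) (∑ l ∈ J i, Polynomial.monomial l ((dehomog (u i).1).coeff l))

/-- The vector with the components `c i * x ^ n i`. -/
noncomputable def purePowers (c : Fin s → ℂ) : Space n :=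
  fun i => ofPoly (n i) (Polynomial.C (c i))

theorem coeff_selectTerms (J : ∀ i, Finset (Fin (n i + 1))) (u : Space n) (i : Fin s)
    (l : Fin (n i + 1)) : (dehomog (selectTerms J u i).1).coeff l =
      if l ∈ J i then (dehomog (u i).1).coeff l else 0 := by
  rw [selectTerms, dehomog_ofPoly, Polynomial.finsetSum_coeff]
  · simp [Polynomial.coeff_monomial, Fin.val_inj]
  · exact Polynomial.natDegree_sum_le_of_forall_le _ _ fun l _ =>
      (Polynomial.natDegree_monomial_le _).trans (Nat.lt_succ_iff.1 l.2)

theorem dehomog_purePowers (c : Fin s → ℂ) (i : Fin s) :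
    dehomog ((purePowers c : Space n) i).1 = Polynomial.C (c i) :=
  dehomog_ofPoly (by simp)

end Orbits

/-! ### Residues extended by zero -/

section Residue

variable {K F : Type*} [Field K] [Field F] {O : ValuationSubring K}

open Classical in
/-- The residue of an element of the valuation ring, extended by zero. -/
noncomputable def res (φ : O →+* F) (x : K) : F := if h : x ∈ O then φ ⟨x, h⟩ else 0

theorem res_coe (φ : O →+* F) (x : O) : res φ x = φ x := by
  rw [res, dif_pos x.2]

theorem mem_of_res_ne_zero {φ : O →+* F} {x : K} (h : res φ x ≠ 0) : x ∈ O := by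
  by_contra hx
  exact h (dif_neg hx)

theorem prod_res_eq_one (φ : O →+* F) [IsLocalHom φ] {ι : Type*} [Fintype ι] {x : ι → K}
    (h : ∀ i, res φ (x i) ≠ 0) {β : ι → ℤ} (hx : ∏ i, x i ^ β i = 1) :
    ∏ i, res φ (x i) ^ β i = 1 := by
  have hx0 : ∀ i, x i ≠ 0 := by
    intro i h0
    apply h i
    rw [h0, ← ZeroMemClass.coe_zero O, res_coe, map_zero]
  have := prod_residue_eq_one φ (x := fun i => Units.mk0 (x i) (hx0 i))
    (c := fun i => Units.mk0 _ (h i)) (β := β)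
    (fun i => ⟨⟨x i, mem_of_res_ne_zero (h i)⟩, rfl, (res_coe φ _).symm⟩)
    (Units.ext (by simpa using hx))
  simpa using congrArg Units.val this

end Residue

/-! ### Reductions in normal form -/

section NormalReduction

theorem Reduces.conj {K F : Type*} [Field K] [Field F] {O : ValuationSubring K} {φ : O →+* F}
    {a : K} {A : Matrix (Fin 2) (Fin 2) K} {f : MvPolynomial (Fin 2) K} {q : MvPolynomial (Fin 2) F}
    (h : Reduces φ (MvPolynomial.C a * TorusSL2.linSubst A f) q)
    (Q : Matrix.SpecialLinearGroup (Fin 2) O) :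
    Reduces φ (MvPolynomial.C a * TorusSL2.linSubst (Q.1.map O.subtype * A) f)
      (TorusSL2.linSubst (Q.1.map φ) q) := by
  have := h.linSubst Q.1
  rwa [map_mul, ← MvPolynomial.algebraMap_eq, AlgHom.commutes, ← AlgHom.comp_apply,
    ← linSubst_mul] at this

variable {k s : ℕ} {χ : Fin s → Fin k → ℤ} {n : Fin s → ℕ}

theorem coe_rep_one (g : Matrix.SpecialLinearGroup (Fin 2) ℂ) (w : Space n) (i : Fin s) :
    (rep χ n (1, g) w i).1 = linSubst g.1 (w i).1 := by
  rw [coe_rep, map_one, Units.val_one, map_one, one_mul]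

variable {K : Type} [Field K] {O : ValuationSubring K}

/-- `w` is the reduction of the vector `(t, g) u`, where `g` is the product of the diagonal matrix
`diag(d, d⁻¹)`, with `d⁻¹` integral, and of the upper unipotent matrix with entry `b`, which
reduces to zero. The constants are embedded into the valuation ring by the section `j` of `φ`. -/
structure NormalReduction (χ : Fin s → Fin k → ℤ) (φ : O →+* ℂ) (j : ℂ →+* O) (t : Fin k → Kˣ)
    (d : Kˣ) (b : K) (u w : Space n) : Prop where
  res_const : ∀ c, φ (j c) = c
  inv_mem : (d : K)⁻¹ ∈ O
  b_mem : b ∈ O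
  res_b : φ ⟨b, b_mem⟩ = 0
  reduces : ∀ i, Reduces φ (MvPolynomial.C ((weightChar t d (χ i, 0) : Kˣ) : K) *
    linSubst !![(d : K), d * b; 0, (d : K)⁻¹] ((u i).1.map (O.subtype.comp j))) (w i).1

/-- By the Cartan decomposition, every point of the orbit closure is, up to the group, a reduction in
normal form of a translate of `v`. -/
theorem exists_normalReduction {v w : Space n} (hw : w ∈ zariskiClosure (orbit χ n v)) :
    ∃ (K : Type) (_ : Field K) (O : ValuationSubring K) (φ : O →+* ℂ) (j : ℂ →+* O)
      (t : Fin k → Kˣ) (d : Kˣ) (b : K) (β : ℂ) (g : Matrix.SpecialLinearGroup (Fin 2) ℂ)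
      (w' : Space n), IsLocalHom φ ∧ (g = 1 ∨ g = weyl ℂ ∧ β = 0) ∧ w ∈ orbit χ n w' ∧
        NormalReduction χ φ j t d b (rep χ n (1, unip β * g) v) w' := by
  obtain ⟨K, _, O, φ, j, t, A, hφ, hj, hA, hred⟩ := exists_reduction hw
  obtain ⟨Q, d, b, β, g, hg, hd, hdO, ⟨hb, hb0⟩, hQ⟩ := exists_cartan φ j hj A hA
  refine ⟨K, inferInstance, O, φ, j, t, Units.mk0 d hd, b, β, g,
    rep χ n (1, Matrix.SpecialLinearGroup.map φ Q) w, hφ, hg, mem_orbit_symm (rep_mem_orbit _ _),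
    hj, hdO, hb, hb0, fun i => ?_⟩
  have := (hred i).conj Q
  rw [hQ, linSubst_mul, AlgHom.comp_apply, ← map_linSubst] at this
  rw [coe_rep_one, coe_rep_one]
  have hwt : weightChar t (Units.mk0 d hd) (χ i, 0) = weightChar t 1 (χ i, 0) := by
    simp [weightChar]
  rw [hwt]
  exact this

variable {φ : O →+* ℂ} {j : ℂ →+* O} {t : Fin k → Kˣ} {d : Kˣ} {b : K} {u w : Space n}

theorem dehomog_C_mul {R : Type*} [CommRing R] (a : R) (f : MvPolynomial (Fin 2) R) :
    dehomog (MvPolynomial.C a * f) = Polynomial.C a * dehomog f := by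
  rw [map_mul]
  congr 1
  simp [dehomog]

theorem weightChar_eq_mul_zpow (P : (Fin k → ℤ) × ℤ) :
    ((weightChar t d P : Kˣ) : K) = (weightChar t d (P.1, 0) : Kˣ) * (d : K) ^ P.2 := by
  simp [weightChar]

/-- If `d` is a unit of the valuation ring, the reduction is obtained from `u` up to the group by
discarding components. -/
theorem NormalReduction.mem_orbit_restrict [IsLocalHom φ]
    (h : NormalReduction χ φ j t d b u w) (hd : (d : K) ∈ O) :
    ∃ J : Finset (Fin s), w ∈ orbit χ n (restrict J u) := by
  classical
  let M : Matrix.SpecialLinearGroup (Fin 2) O :=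
    ⟨!![⟨d, hd⟩, ⟨d, hd⟩ * ⟨b, h.b_mem⟩; 0, ⟨_, h.inv_mem⟩], by
      rw [Matrix.det_fin_two]
      exact Subtype.ext (by simp)⟩
  have hM : M.1.map O.subtype = !![(d : K), d * b; 0, (d : K)⁻¹] := by
    ext p q
    fin_cases p <;> fin_cases q <;> simp [M]
  have hMM : (M⁻¹).1.map O.subtype * !![(d : K), d * b; 0, (d : K)⁻¹] = 1 := by
    rw [← hM, ← Matrix.map_mul, ← Matrix.SpecialLinearGroup.coe_mul, inv_mul_cancel,
      Matrix.SpecialLinearGroup.coe_one, Matrix.map_one _ (map_zero _) (map_one _)]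
  let w' : Space n := rep χ n (1, Matrix.SpecialLinearGroup.map φ M⁻¹) w
  have hww' : w ∈ orbit χ n w' := mem_orbit_symm (rep_mem_orbit _ _)
  have hw' : ∀ i l, (dehomog (w' i).1).coeff l =
      res φ ((weightChar t d (χ i, 0) : Kˣ) : K) * (dehomog (u i).1).coeff l := by
    intro i l
    have h1 := (h.reduces i).conj M⁻¹
    rw [hMM, linSubst_one, AlgHom.id_apply] at h1
    obtain ⟨H, hH, hHw⟩ := h1.dehomog
    have h2 : dehomog (w' i).1 = H.map φ := by
      rw [hHw, coe_rep_one]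
      rfl
    rw [dehomog_C_mul, dehomog_map, ← Polynomial.map_map] at hH
    have h3 : ((dehomog (u i).1).map j).map φ = dehomog (u i).1 := by
      rw [Polynomial.map_map]
      conv_rhs => rw [← Polynomial.map_id (p := dehomog (u i).1)]
      congr 1
      ext c
      exact h.res_const c
    by_cases h0 : dehomog (u i).1 = 0
    · rw [h0, Polynomial.map_zero, Polynomial.map_zero, mul_zero,
        Polynomial.map_eq_zero_iff Subtype.val_injective] at hH
      simp [h2, hH, h0]
    · obtain ⟨s', hs', hs2⟩ := exists_scalar_of_map_eq φ hH (by rwa [h3])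
      rw [h2, hs2, h3, Polynomial.coeff_C_mul, ← hs', res_coe]
  refine ⟨Finset.univ.filter fun i => res φ ((weightChar t d (χ i, 0) : Kˣ) : K) ≠ 0, mem_orbit_trans hww'
    (mem_orbit_of_coeff (fun i _ => res φ ((weightChar t d (χ i, 0) : Kˣ) : K)) ?_ ?_ ?_)⟩
  · intro i l
    rw [hw']
    by_cases h0 : res φ ((weightChar t d (χ i, 0) : Kˣ) : K) = 0
    · rw [h0, zero_mul, zero_mul]
    · rw [restrict, if_pos (by simpa using h0)]
  · intro i l hne h0
    rw [restrict, if_neg (by simpa using h0)] at hne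
    simp at hne
  · intro β hβ
    refine prod_res_eq_one φ (fun p => ?_) ?_
    · intro h0
      apply p.2
      rw [restrict, if_neg (by simpa using h0)]
      simp
    · have h1 : ∑ p, β p • ((χ p.1.1, 0) : (Fin k → ℤ) × ℤ) = 0 := by
        refine Prod.ext ?_ (by simp [Prod.snd_sum])
        have := congrArg Prod.fst hβ
        simpa [Prod.fst_sum] using this
      have h2 := weightChar_sum_zsmul t d Finset.univ β (fun p => (χ p.1.1, 0))
      rw [h1, weightChar_zero] at h2
      have h3 := congrArg Units.val h2
      push_cast at h3
      exact h3.symm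

/-- If `d² b` is integral, the unipotent matrix can be moved to the left of the diagonal matrix, and
the reduction is obtained from `u` up to the group by discarding terms. -/
theorem NormalReduction.mem_orbit_selectTerms [IsLocalHom φ]
    (h : NormalReduction χ φ j t d b u w) (hdb : (d : K) ^ 2 * b ∈ O) :
    ∃ J : ∀ i, Finset (Fin (n i + 1)), w ∈ orbit χ n (selectTerms J u) := by
  classical
  let M : Matrix.SpecialLinearGroup (Fin 2) O := unip (-⟨_, hdb⟩)
  have hMM : M.1.map O.subtype * !![(d : K), d * b; 0, (d : K)⁻¹] =
      !![(d : K), d * 0; 0, d * ((d : K)⁻¹ ^ 2)] := by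
    have hd0 : (d : K) ≠ 0 := d.ne_zero
    ext p q
    fin_cases p <;> fin_cases q <;>
      simp [M, unip, Matrix.mul_apply, Fin.sum_univ_two]
    · field_simp
      ring
    · field_simp
  let w' : Space n := rep χ n (1, Matrix.SpecialLinearGroup.map φ M) w
  have hww' : w ∈ orbit χ n w' := mem_orbit_symm (rep_mem_orbit _ _)
  let x : Fin s → ℕ → K := fun i l => (weightChar t d (χ i, (n i : ℤ) - 2 * l) : Kˣ)
  have hw' : ∀ i l, (dehomog (w' i).1).coeff l = res φ (x i l) * (dehomog (u i).1).coeff l := by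
    intro i l
    have h1 := (h.reduces i).conj M
    rw [hMM] at h1
    obtain ⟨H, hH, hHw⟩ := h1.dehomog
    have h2 : dehomog (w' i).1 = H.map φ := by
      rw [hHw, coe_rep_one]
      rfl
    rw [dehomog_C_mul, dehomog_linSubst (MvPolynomial.IsHomogeneous.map (u i).2 _), dehomog_map,
      map_zero, zero_add] at hH
    have h3 := congrArg (fun P => P.coeff l) hH
    simp only [Polynomial.coeff_C_mul, Polynomial.comp_C_mul_X_coeff, Polynomial.coeff_map] at h3
    have h4 : (H.coeff l : K) = x i l * j ((dehomog (u i).1).coeff l) := by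
      refine Eq.trans h3 ?_
      have : x i l = (weightChar t d (χ i, 0) : Kˣ) * ((d : K) ^ n i * ((d : K)⁻¹ ^ 2) ^ l) := by
        show ((weightChar t d (χ i, (n i : ℤ) - 2 * l) : Kˣ) : K) = _
        rw [weightChar_eq_mul_zpow, zpow_sub₀ d.ne_zero, zpow_mul, zpow_natCast, zpow_natCast,
          div_eq_mul_inv, inv_pow, inv_pow]
        norm_cast
      rw [this]
      simp only [RingHom.comp_apply, ValuationSubring.subtype_apply]
      ring
    rw [h2, Polynomial.coeff_map]
    by_cases h0 : (dehomog (u i).1).coeff l = 0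
    · rw [h0, map_zero, ZeroMemClass.coe_zero, mul_zero] at h4
      have : H.coeff l = 0 := Subtype.ext h4
      rw [this, map_zero, h0, mul_zero]
    · have h5 : x i l = ((H.coeff l * j ((dehomog (u i).1).coeff l)⁻¹ : O) : K) := by
        have : ((j ((dehomog (u i).1).coeff l) * j ((dehomog (u i).1).coeff l)⁻¹ : O) : K) = 1 := by
          rw [← map_mul, mul_inv_cancel₀ h0, map_one]
          rfl
        rw [MulMemClass.coe_mul] at this
        rw [MulMemClass.coe_mul, h4, mul_assoc, this, mul_one]
      rw [h5, res_coe, map_mul, h.res_const, mul_assoc, inv_mul_cancel₀ h0, mul_one]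
  have hsel : ∀ i l, (dehomog (selectTerms
      (fun i => {l : Fin (n i + 1) | res φ (x i l) ≠ 0}) u i).1).coeff l =
        if res φ (x i l) ≠ 0 then (dehomog (u i).1).coeff l else 0 := by
    intro i l
    by_cases hl : l < n i + 1
    · have := coeff_selectTerms (fun i => {l : Fin (n i + 1) | res φ (x i l) ≠ 0}) u i ⟨l, hl⟩
      rw [this]
      simp
    · rw [coeff_dehomog_eq_zero _ (by omega), coeff_dehomog_eq_zero _ (by omega), ite_self]
  refine ⟨fun i => {l | res φ (x i l) ≠ 0}, mem_orbit_trans hww'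
    (mem_orbit_of_coeff (fun i l => res φ (x i l)) ?_ ?_ ?_)⟩
  · intro i l
    rw [hw', hsel]
    by_cases h0 : res φ (x i l) = 0
    · rw [h0, zero_mul, zero_mul]
    · rw [if_pos h0]
  · intro i l hne h0
    rw [hsel, if_neg (by simpa using h0)] at hne
    exact hne rfl
  · intro β hβ
    refine prod_res_eq_one φ (fun p => ?_) ?_
    · intro h0
      apply p.2
      rw [hsel, if_neg (by simpa using h0)]
    · have h2 := weightChar_sum_zsmul t d Finset.univ β
        (fun p => ((χ p.1.1, (n p.1.1 : ℤ) - 2 * (p.1.2 : ℕ)) : (Fin k → ℤ) × ℤ))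
      rw [hβ, weightChar_zero] at h2
      have h3 := congrArg Units.val h2
      push_cast at h3
      exact h3.symm

end NormalReduction

/-! ### Reductions consisting of powers of `x` -/

section PurePowers

variable {K : Type} [Field K] {O : ValuationSubring K} {φ : O →+* ℂ}

theorem prod_zpow_eq_zpow_sum₀ {ι G : Type*} [CommGroupWithZero G] (s : Finset ι) {b : G}
    (hb : b ≠ 0) (f : ι → ℤ) : ∏ i ∈ s, b ^ f i = b ^ ∑ i ∈ s, f i := by
  classical
  induction s using Finset.induction_on with
  | empty => simp
  | insert i s hi ih => rw [Finset.prod_insert hi, Finset.sum_insert hi, zpow_add₀ hb, ih]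

theorem exists_unit_eq_prod_zpow [IsLocalHom φ] {ι : Type*} [Fintype ι] {x : ι → K}
    (h : ∀ i, res φ (x i) ≠ 0) (β : ι → ℤ) : ∃ y : Oˣ, ((y : O) : K) = ∏ i, x i ^ β i := by
  have h' : ∀ i, ∃ y : Oˣ, ((y : O) : K) = x i := by
    intro i
    have hx := mem_of_res_ne_zero (h i)
    have hu : IsUnit (⟨x i, hx⟩ : O) := by
      refine IsUnit.of_map φ _ (Ne.isUnit ?_)
      have := h i
      rwa [res, dif_pos hx] at this
    exact ⟨hu.unit, rfl⟩
  choose y hy using h'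
  refine ⟨∏ i, y i ^ β i, ?_⟩
  have : Units.map (O.subtype : O →* K) (∏ i, y i ^ β i) =
      ∏ i, Units.map (O.subtype : O →* K) (y i) ^ β i := by simp [map_prod]
  have h1 := congrArg Units.val this
  push_cast at h1
  refine Eq.trans h1 (Finset.prod_congr rfl fun i _ => ?_)
  exact congrArg (· ^ β i) (hy i)

/-- A power of an element reducing to zero is a unit only if the exponent is zero. -/
theorem eq_zero_of_zpow_eq_unit {b : O} (hb : φ b = 0) {N : ℤ} {y : Oˣ}
    (h : ((y : O) : K) = (b : K) ^ N) (hb0 : (b : K) ≠ 0) : N = 0 := by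
  have hy : φ y ≠ 0 := (y.isUnit.map φ).ne_zero
  obtain ⟨m, rfl | rfl⟩ := N.eq_nat_or_neg
  · by_contra hm
    have h1 : (y : O) = b ^ m := Subtype.ext (by simpa using h)
    apply hy
    rw [h1, map_pow, hb, zero_pow (by simpa using hm)]
  · by_contra hm
    have h1 : (y : O) * b ^ m = 1 := by
      refine Subtype.ext ?_
      show ((y : O) : K) * ((b ^ m : O) : K) = 1
      rw [h, zpow_neg, zpow_natCast, SubmonoidClass.coe_pow, inv_mul_cancel₀ (pow_ne_zero _ hb0)]
    have h2 := congrArg φ h1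
    rw [map_mul, map_pow, hb, zero_pow (by simpa using hm), mul_zero, map_one] at h2
    exact zero_ne_one h2

open Polynomial in
/-- A power of a linear polynomial whose constant term dominates reduces to a constant. -/
theorem exists_reduction_linear_pow {b r : K} (e : ℕ)
    (h : e = 0 ∨ (b ≠ 0 ∧ ∃ hm : r / b ∈ O, φ ⟨r / b, hm⟩ = 0)) :
    ∃ E : O[X], (C b + C r * X) ^ e = C (b ^ e) * E.map O.subtype ∧ E.map φ = 1 := by
  rcases h with rfl | ⟨hb, hm, hres⟩
  · exact ⟨1, by simp, by simp⟩
  · refine ⟨(1 + C ⟨r / b, hm⟩ * X) ^ e, ?_, ?_⟩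
    · rw [Polynomial.map_pow, C_pow, ← mul_pow]
      congr 1
      simp only [Polynomial.map_add, Polynomial.map_one, Polynomial.map_mul, Polynomial.map_C,
        Polynomial.map_X, ValuationSubring.subtype_apply]
      rw [mul_add, mul_one, ← mul_assoc, ← C_mul, mul_div_cancel₀ _ hb]
    · simp [hres]

theorem exists_eq_X_pow_mul (F : Polynomial ℂ) : ∃ F₁ : Polynomial ℂ,
    F = Polynomial.X ^ F.natTrailingDegree * F₁ ∧ F₁.coeff 0 = F.trailingCoeff := by
  obtain ⟨F₁, hF₁⟩ : Polynomial.X ^ F.natTrailingDegree ∣ F :=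
    Polynomial.X_pow_dvd_iff.2 fun _ hd => Polynomial.coeff_eq_zero_of_lt_natTrailingDegree hd
  refine ⟨F₁, hF₁, ?_⟩
  rw [Polynomial.trailingCoeff]
  conv_rhs => rw [hF₁]
  have := Polynomial.coeff_X_pow_mul F₁ F.natTrailingDegree 0
  rw [zero_add] at this
  rw [← this, ← hF₁]

variable {k s : ℕ} {χ : Fin s → Fin k → ℤ} {n : Fin s → ℕ}
  {j : ℂ →+* O} {t : Fin k → Kˣ} {d : Kˣ} {b : K} {u w : Space n}

/-- If `d⁻¹` reduces to zero and the terms `y + d² b x` are dominated by `d² b x`, unless `y` does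
not divide the form, then the reduction consists of multiples of powers of `x`. -/
theorem NormalReduction.mem_orbit_purePowers [IsLocalHom φ]
    (h : NormalReduction χ φ j t d b u w) (hd : φ ⟨_, h.inv_mem⟩ = 0)
    (hdb : ∀ i, u i ≠ 0 → (dehomog (u i).1).natTrailingDegree = 0 ∨
      (b ≠ 0 ∧ ∃ hm : ((d : K) ^ 2 * b)⁻¹ ∈ O, φ ⟨_, hm⟩ = 0))
    (x : Fin s → K) (hx : ∀ i, x i = (weightChar t d (χ i, n i) : Kˣ) *
      b ^ (dehomog (u i).1).natTrailingDegree) :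
    (∀ i, u i ≠ 0 → x i ∈ O) ∧ w ∈ orbit χ n (purePowers fun i =>
      if res φ (x i) ≠ 0 then (dehomog (u i).1).trailingCoeff else 0) := by
  classical
  have hr2 : φ (⟨_, h.inv_mem⟩ ^ 2) = 0 := by rw [map_pow, hd, zero_pow two_ne_zero]
  have key : ∀ i, u i ≠ 0 → x i ∈ O ∧ dehomog (w i).1 =
      Polynomial.C (res φ (x i) * (dehomog (u i).1).trailingCoeff) := by
    intro i hi
    set F := dehomog (u i).1
    have hF0 : F ≠ 0 := dehomog_ne_zero hi
    obtain ⟨F₁, hF₁, hF₁0⟩ := exists_eq_X_pow_mul F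
    obtain ⟨E, hE, hE1⟩ := exists_reduction_linear_pow (φ := φ) (b := b) (r := (d : K)⁻¹ ^ 2)
      F.natTrailingDegree (by
        rcases hdb i hi with h0 | ⟨hb, hm, hres⟩
        · exact Or.inl h0
        · have heq : (d : K)⁻¹ ^ 2 / b = ((d : K) ^ 2 * b)⁻¹ := by
            rw [mul_inv, inv_pow, div_eq_mul_inv]
          refine Or.inr ⟨hb, heq ▸ hm, ?_⟩
          rw [← hres]
          congr 1
          exact Subtype.ext heq)
    let G : Polynomial O := (F₁.map j).comp
      (Polynomial.C ⟨b, h.b_mem⟩ + Polynomial.C (⟨_, h.inv_mem⟩ ^ 2) * Polynomial.X)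
    have hφj : φ.comp j = RingHom.id ℂ := RingHom.ext h.res_const
    have hG : G.map φ = Polynomial.C F.trailingCoeff := by
      simp only [G, Polynomial.map_comp, Polynomial.map_map, hφj, Polynomial.map_id,
        Polynomial.map_add, Polynomial.map_mul, Polynomial.map_C, Polynomial.map_X, h.res_b, hr2]
      rw [map_zero, zero_mul, add_zero, ← map_zero Polynomial.C, Polynomial.comp_C,
        ← Polynomial.coeff_zero_eq_eval_zero, hF₁0]
    have hGK : G.map O.subtype = (F₁.map (O.subtype.comp j)).comp
        (Polynomial.C b + Polynomial.C ((d : K)⁻¹ ^ 2) * Polynomial.X) := by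
      simp [G, Polynomial.map_comp, Polynomial.map_map]
    obtain ⟨H, hH, hHw⟩ := (h.reduces i).dehomog
    have hMat : !![(d : K), d * b; 0, (d : K)⁻¹] =
        !![(d : K), d * b; 0, d * ((d : K)⁻¹ ^ 2)] := by
      rw [pow_two, ← mul_assoc, mul_inv_cancel₀ d.ne_zero, one_mul]
    rw [dehomog_C_mul, hMat, dehomog_linSubst (MvPolynomial.IsHomogeneous.map (u i).2 _),
      dehomog_map] at hH
    have hH' : H.map O.subtype = Polynomial.C (x i) * (E * G).map O.subtype := by
      rw [hH, Polynomial.map_mul, hGK]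
      have : (F.map (O.subtype.comp j)).comp
          (Polynomial.C b + Polynomial.C ((d : K)⁻¹ ^ 2) * Polynomial.X) =
          (Polynomial.C b + Polynomial.C ((d : K)⁻¹ ^ 2) * Polynomial.X) ^ F.natTrailingDegree *
          (F₁.map (O.subtype.comp j)).comp
            (Polynomial.C b + Polynomial.C ((d : K)⁻¹ ^ 2) * Polynomial.X) := by
        conv_lhs => rw [hF₁]
        rw [Polynomial.map_mul, Polynomial.map_pow, Polynomial.map_X, Polynomial.mul_comp,
          Polynomial.pow_comp, Polynomial.X_comp]
      have hxi : x i = (weightChar t d (χ i, 0) : Kˣ) * (d : K) ^ n i * b ^ F.natTrailingDegree := by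
        rw [hx i, weightChar_eq_mul_zpow (χ i, (n i : ℤ)), zpow_natCast]
      rw [show dehomog (u i).1 = F from rfl, this, hE, hxi]
      simp only [Polynomial.C_mul]
      ring
    have hEG : (E * G).map φ = Polynomial.C F.trailingCoeff := by
      rw [Polynomial.map_mul, hE1, hG, one_mul]
    obtain ⟨s', hs', hs2⟩ := exists_scalar_of_map_eq φ hH' (by
      rw [hEG, Ne, Polynomial.C_eq_zero]
      exact Polynomial.trailingCoeff_nonzero_iff_nonzero.2 hF0)
    rw [← hs', res_coe]
    refine ⟨s'.2, ?_⟩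
    rw [← hHw, hs2, hEG, Polynomial.C_mul]
  refine ⟨fun i hi => (key i hi).1, mem_orbit_of_coeff (fun i _ => res φ (x i)) ?_ ?_ ?_⟩
  · intro i l
    rw [dehomog_purePowers]
    by_cases hi : u i = 0
    · have hwi : dehomog (w i).1 = 0 := by
        obtain ⟨H, hH, hHw⟩ := (h.reduces i).dehomog
        rw [hi, ZeroMemClass.coe_zero, map_zero, map_zero, mul_zero, map_zero,
          Polynomial.map_eq_zero_iff Subtype.val_injective] at hH
        rw [← hHw, hH, Polynomial.map_zero]
      simp [hwi, hi]
    · rw [(key i hi).2, ← Polynomial.coeff_C_mul, ← Polynomial.C_mul]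
      by_cases h0 : res φ (x i) = 0
      · simp [h0]
      · rw [if_pos h0]
  · intro i l hne h0
    rw [dehomog_purePowers, if_neg (by simpa using h0)] at hne
    simp at hne
  · intro β hβ
    have hres : ∀ p : {p : Σ i, Fin (n i + 1) // (dehomog ((purePowers fun i =>
        if res φ (x i) ≠ 0 then (dehomog (u i).1).trailingCoeff else 0 : Space n) p.1).1).coeff
          p.2 ≠ 0}, res φ (x p.1.1) ≠ 0 := by
      intro p h0
      apply p.2
      rw [dehomog_purePowers, if_neg (by simpa using h0)]
      simp
    have hl : ∀ p : {p : Σ i, Fin (n i + 1) // (dehomog ((purePowers fun i =>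
        if res φ (x i) ≠ 0 then (dehomog (u i).1).trailingCoeff else 0 : Space n) p.1).1).coeff
          p.2 ≠ 0}, (p.1.2 : ℕ) = 0 := by
      intro p
      by_contra h0
      apply p.2
      rw [dehomog_purePowers, Polynomial.coeff_C_of_ne_zero h0]
    refine prod_res_eq_one φ hres ?_
    have hw : ∏ p, ((weightChar t d (χ p.1.1, n p.1.1) : Kˣ) : K) ^ β p = 1 := by
      have h1 : ∑ p, β p • ((χ p.1.1, (n p.1.1 : ℤ)) : (Fin k → ℤ) × ℤ) = 0 := by
        rw [← hβ]
        refine Finset.sum_congr rfl fun p _ => ?_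
        rw [hl p, Nat.cast_zero, mul_zero, sub_zero]
      have h2 := weightChar_sum_zsmul t d Finset.univ β (fun p => (χ p.1.1, (n p.1.1 : ℤ)))
      rw [h1, weightChar_zero] at h2
      have h3 := congrArg Units.val h2
      push_cast at h3
      exact h3.symm
    -- The product of the powers of `b` is a unit, although `b` reduces to zero.
    have hprod : ∏ p, x p.1.1 ^ β p =
        ∏ p, (b ^ (dehomog (u p.1.1).1).natTrailingDegree) ^ β p := by
      have h1 : ∏ p, x p.1.1 ^ β p =
          (∏ p, ((weightChar t d (χ p.1.1, n p.1.1) : Kˣ) : K) ^ β p) *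
            ∏ p, (b ^ (dehomog (u p.1.1).1).natTrailingDegree) ^ β p := by
        rw [← Finset.prod_mul_distrib]
        exact Finset.prod_congr rfl fun p _ => by rw [hx, mul_zpow]
      rw [h1, hw, one_mul]
    by_cases hb : b = 0
    · rw [hprod]
      refine Finset.prod_eq_one fun p _ => ?_
      have h0 : (dehomog (u p.1.1).1).natTrailingDegree = 0 := by
        by_contra h0
        apply hres p
        rw [hx, hb, zero_pow h0, mul_zero, ← ZeroMemClass.coe_zero O, res_coe, map_zero]
      rw [h0, pow_zero, one_zpow]
    · have hpow : ∏ p, (b ^ (dehomog (u p.1.1).1).natTrailingDegree) ^ β p =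
          b ^ (∑ p, ((dehomog (u p.1.1).1).natTrailingDegree : ℤ) * β p) := by
        rw [Finset.prod_congr rfl fun p _ => by
          rw [← zpow_natCast, ← zpow_mul]]
        exact prod_zpow_eq_zpow_sum₀ _ hb _
      obtain ⟨y, hy⟩ := exists_unit_eq_prod_zpow hres β
      rw [hprod, hpow] at hy
      rw [hprod, hpow, eq_zero_of_zpow_eq_unit (b := ⟨b, h.b_mem⟩) h.res_b hy hb, zpow_zero]

end PurePowers

/-! ### Rational weights from valuations -/

section RationalWeight

variable {K F : Type*} [Field K] [Field F] {O : ValuationSubring K} {φ : O →+* F}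

/-- The valuations of the coordinates of a point of the torus can be replaced by rational numbers,
so that finitely many integral characters keep the signs of their valuations. -/
theorem exists_rational_weight [IsLocalHom φ] {k : ℕ} {ι : Type*} [Fintype ι]
    (t : Fin k → Kˣ) (d : Kˣ) (hd : (d : K)⁻¹ ∈ O) (hd0 : φ ⟨_, hd⟩ = 0)
    (P : ι → (Fin k → ℤ) × ℤ) (hP : ∀ i, ((weightChar t d (P i) : Kˣ) : K) ∈ O) :
    ∃ R : (Fin k → ℚ) × ℚ, R.2 < 0 ∧ ∀ i,
      0 ≤ pairing (fun l => ((P i).1 l : ℚ), ((P i).2 : ℚ)) R ∧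
      (pairing (fun l => ((P i).1 l : ℚ), ((P i).2 : ℚ)) R = 0 ↔
        res φ ((weightChar t d (P i) : Kˣ) : K) ≠ 0) := by
  classical
  let val : Kˣ →* O.ValueGroupˣ := Units.map (O.valuation : K →* O.ValueGroup)
  have hlt : ∀ x : O, φ x = 0 → O.valuation (x : K) < 1 := by
    intro x hx
    rw [← O.valuation_lt_one_iff, IsLocalRing.mem_maximalIdeal]
    intro hu
    exact (hu.map φ).ne_zero hx
  have heq : ∀ x : O, φ x ≠ 0 → O.valuation (x : K) = 1 := by
    intro x hx
    rw [← O.valuation_eq_one_iff]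
    exact IsUnit.of_map φ _ hx.isUnit
  let a : Option ι → Additive O.ValueGroupˣ := fun o => o.elim
    (Additive.ofMul (val d)) fun i => Additive.ofMul (val (weightChar t d (P i)))⁻¹
  have hpos : ∀ x : Kˣ, O.valuation (x : K) < 1 → 0 < Additive.ofMul (val x)⁻¹ := by
    intro x hx
    have h1 : val x < 1 := by
      rw [← Units.val_lt_val]
      exact hx
    exact one_lt_inv'.2 h1
  obtain ⟨f, hf⟩ := exists_hom_pos
    (Finset.univ.filter fun o : Option ι => ∀ i, o = some i →
      res φ ((weightChar t d (P i) : Kˣ) : K) = 0) a (by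
    rintro (_ | i) hi
    · have := hpos d⁻¹ (by
        have := hlt ⟨_, hd⟩ hd0
        rwa [Units.val_inv_eq_inv_val])
      rwa [map_inv val, inv_inv] at this
    · have h0 := (Finset.mem_filter.1 hi).2 i rfl
      refine hpos _ (hlt ⟨_, hP i⟩ ?_)
      rwa [res, dif_pos (hP i)] at h0)
  let R : (Fin k → ℚ) × ℚ :=
    (fun l => -f (Additive.ofMul (val (t l))), -f (Additive.ofMul (val d)))
  have hR : ∀ i, pairing (fun l => ((P i).1 l : ℚ), ((P i).2 : ℚ)) R =
      f (Additive.ofMul (val (weightChar t d (P i)))⁻¹) := by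
    intro i
    simp only [pairing, R]
    rw [ofMul_inv, map_neg, map_weightChar, weightChar, ofMul_mul, ofMul_prod, map_add, map_sum]
    simp only [ofMul_zpow, map_zsmul, zsmul_eq_mul]
    rw [neg_add, ← Finset.sum_neg_distrib]
    congr 1
    · exact Finset.sum_congr rfl fun l _ => by ring
    · ring
  refine ⟨R, ?_, fun i => ?_⟩
  · have : 0 < f (Additive.ofMul (val d)) := hf none (by simp)
    exact neg_neg_of_pos this
  · rw [hR]
    by_cases h0 : res φ ((weightChar t d (P i) : Kˣ) : K) = 0
    · have : 0 < f (Additive.ofMul (val (weightChar t d (P i)))⁻¹) := hf (some i) (by simp [h0])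
      exact ⟨this.le, fun h => absurd h this.ne', fun h => absurd h0 h⟩
    · have h1 : val (weightChar t d (P i)) = 1 := by
        refine Units.ext (heq ⟨_, hP i⟩ ?_)
        rwa [res, dif_pos (hP i)] at h0
      rw [h1, inv_one, ofMul_one, map_zero]
      exact ⟨le_rfl, fun _ => h0, fun _ => rfl⟩

end RationalWeight

/-! ### Description of the orbit closure -/

section Closure

variable {k s : ℕ} {χ : Fin s → Fin k → ℤ} {n : Fin s → ℕ}

theorem dehomog_rep_unip (β : ℂ) (v : Space n) (i : Fin s) :
    dehomog (rep χ n (1, unip β) v i).1 =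
      (dehomog (v i).1).comp (Polynomial.C β + Polynomial.X) := by
  have hM : (unip β).1 = !![(1 : ℂ), 1 * β; 0, 1 * 1] := by simp [unip]
  rw [coe_rep_one, hM, dehomog_linSubst (v i).2]
  simp

theorem coeff_zero_dehomog_rep_unip (β : ℂ) (v : Space n) (i : Fin s) :
    (dehomog (rep χ n (1, unip β) v i).1).coeff 0 = (dehomog (v i).1).eval β := by
  rw [dehomog_rep_unip, Polynomial.coeff_zero_eq_eval_zero, Polynomial.eval_comp]
  simp

theorem rep_apply_eq_zero_iff (g : Grp k) (v : Space n) (i : Fin s) :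
    rep χ n g v i = 0 ↔ v i = 0 := by
  have h : ∀ (g : Grp k) (v : Space n), v i = 0 → rep χ n g v i = 0 := by
    intro g v h
    show simpleRep (χ i) (n i) g (v i) = 0
    rw [h, map_zero]
  refine ⟨fun h0 => ?_, h g v⟩
  have := h g⁻¹ _ h0
  rwa [← Module.End.mul_apply, ← map_mul, inv_mul_cancel, map_one, Module.End.one_apply] at this

/-- The translates `u` of `v` for which the coefficient of `x ^ n i` in some component of `u` may
vanish. -/
def exceptionalTranslates (χ : Fin s → Fin k → ℤ) (v : Space n) : Set (Space n) :=
  insert (rep χ n (1, weyl ℂ) v) ((fun β => rep χ n (1, unip β) v) ''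
    {β | ∃ i, v i ≠ 0 ∧ (dehomog (v i).1).eval β = 0})

theorem finite_exceptionalTranslates (v : Space n) : (exceptionalTranslates χ v).Finite := by
  refine Set.Finite.insert _ (Set.Finite.image _ ?_)
  have : {β | ∃ i, v i ≠ 0 ∧ (dehomog (v i).1).eval β = 0} ⊆
      ⋃ i, {β | β ∈ (dehomog (v i).1).roots} := by
    rintro β ⟨i, hi, hβ⟩
    exact Set.mem_iUnion.2 ⟨i, (Polynomial.mem_roots (dehomog_ne_zero hi)).2 hβ⟩
  refine Set.Finite.subset (Set.finite_iUnion fun i => ?_) this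
  exact (Multiset.finite_toSet _)

open scoped Classical in
/-- The limit of the translate of `v` by the unipotent matrix with entry `β` along the
one-parameter subgroup `R`. -/
noncomputable def limitPoint (χ : Fin s → Fin k → ℤ) (v : Space n) (R : (Fin k → ℚ) × ℚ) (β : ℂ) :
    Space n :=
  purePowers fun i =>
    if v i ≠ 0 ∧ pairing (charPoint (χ i) (n i)) R = 0 then (dehomog (v i).1).eval β else 0

/-- Every point of the orbit closure lies, up to the group, in one of finitely many families: the
vectors obtained from `v` by discarding components, the limits of generic translates of `v` along
one-parameter subgroups, and finitely many further points coming from exceptional translates. -/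
theorem mem_zariskiClosure_cases {v w : Space n} (hw : w ∈ zariskiClosure (orbit χ n v)) :
    (∃ J : Finset (Fin s), w ∈ orbit χ n (restrict J v)) ∨
    (∃ (R : (Fin k → ℚ) × ℚ) (β : ℂ), R.2 < 0 ∧
      (∀ i, v i ≠ 0 → 0 ≤ pairing (charPoint (χ i) (n i)) R) ∧
      (∀ i, v i ≠ 0 → (dehomog (v i).1).eval β ≠ 0) ∧ w ∈ orbit χ n (limitPoint χ v R β)) ∨
    ∃ u ∈ exceptionalTranslates χ v,
      (∃ J : ∀ i, Finset (Fin (n i + 1)), w ∈ orbit χ n (selectTerms J u)) ∨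
      ∃ J : Finset (Fin s), w ∈ orbit χ n
        (purePowers fun i => if i ∈ J then (dehomog (u i).1).trailingCoeff else 0) := by
  classical
  obtain ⟨K, _, O, φ, j, t, d, b, β, g, w', hφ, hg, hww', h⟩ := exists_normalReduction hw
  set u := rep χ n (1, unip β * g) v with hu
  by_cases hd : φ ⟨_, h.inv_mem⟩ = 0
  · by_cases hgen : g = 1 ∧ ∀ i, v i ≠ 0 → (dehomog (v i).1).eval β ≠ 0
    · obtain ⟨hg1, hgen⟩ := hgen
      rw [hg1, mul_one] at hu
      have hui : ∀ i, u i ≠ 0 → v i ≠ 0 := fun i hi h0 =>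
        hi (by rw [hu]; exact (rep_apply_eq_zero_iff _ _ _).2 h0)
      have hui' : ∀ i, v i ≠ 0 → u i ≠ 0 := fun i hi h0 =>
        hi (by rw [hu] at h0; exact (rep_apply_eq_zero_iff _ _ _).1 h0)
      have hdeg : ∀ i, (dehomog (u i).1).natTrailingDegree = 0 := by
        intro i
        by_cases hi : u i = 0
        · simp [hi]
        · refine Polynomial.natTrailingDegree_eq_zero.2 (Or.inr ?_)
          rw [hu, coeff_zero_dehomog_rep_unip]
          exact hgen i (hui i hi)
      obtain ⟨hx, hx'⟩ := h.mem_orbit_purePowers hd (fun i _ => Or.inl (hdeg i))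
        (fun i => (weightChar t d (χ i, n i) : Kˣ)) (fun i => by rw [hdeg i, pow_zero, mul_one])
      obtain ⟨R, hR, hRi⟩ := exists_rational_weight t d h.inv_mem hd
        (fun i : {i // v i ≠ 0} => ((χ i.1, (n i.1 : ℤ)) : (Fin k → ℤ) × ℤ))
        (fun i => hx i.1 (hui' i.1 i.2))
      have hpair : ∀ i, pairing (charPoint (χ i) (n i)) R =
          pairing (fun l => (χ i l : ℚ), (((n i : ℕ) : ℤ) : ℚ)) R := by
        intro i
        simp [charPoint]
      refine Or.inr (Or.inl ⟨R, β, hR, fun i hi => ?_, hgen, mem_orbit_trans hww' ?_⟩)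
      · rw [hpair]
        exact (hRi ⟨i, hi⟩).1
      · convert hx' using 2
        rw [limitPoint]
        congr 1
        funext i
        by_cases hi : v i = 0
        · have : u i = 0 := by
            rw [hu]
            exact (rep_apply_eq_zero_iff _ _ _).2 hi
          simp [hi, this]
        · rw [Polynomial.trailingCoeff, hdeg i, hu, coeff_zero_dehomog_rep_unip]
          refine if_congr ?_ rfl rfl
          rw [hpair, (hRi ⟨i, hi⟩).2]
          exact and_iff_right hi
    · have hmem : u ∈ exceptionalTranslates χ v := by
        rcases hg with hg | ⟨hg, hβ⟩
        · rw [hu, hg, mul_one]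
          refine Set.mem_insert_of_mem _ ⟨β, ?_, rfl⟩
          by_contra hno
          refine hgen ⟨hg, fun i hi h0 => hno ⟨i, hi, h0⟩⟩
        · have : unip (0 : ℂ) * g = weyl ℂ := by
            have h1 : unip (0 : ℂ) = 1 := by
              ext p q
              fin_cases p <;> fin_cases q <;> simp [unip]
            rw [h1, one_mul, hg]
          rw [hu, hβ, this]
          exact Set.mem_insert _ _
      refine Or.inr (Or.inr ⟨u, hmem, ?_⟩)
      by_cases hdb : (d : K) ^ 2 * b ∈ O
      · obtain ⟨J, hJ⟩ := h.mem_orbit_selectTerms hdb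
        exact Or.inl ⟨J, mem_orbit_trans hww' hJ⟩
      · have hinv := (O.mem_or_inv_mem ((d : K) ^ 2 * b)).resolve_left hdb
        have hb : b ≠ 0 := by
          rintro rfl
          exact hdb (by rw [mul_zero]; exact O.zero_mem)
        have hres : φ ⟨_, hinv⟩ = 0 := by
          by_contra h0
          have hunit : IsUnit (⟨_, hinv⟩ : O) := IsUnit.of_map φ _ (Ne.isUnit h0)
          obtain ⟨z, hz⟩ := isUnit_iff_exists_inv.1 hunit
          have hz' : ((d : K) ^ 2 * b)⁻¹ * z = 1 := congrArg Subtype.val hz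
          have := eq_inv_of_mul_eq_one_right hz'
          rw [inv_inv] at this
          exact hdb (this ▸ z.2)
        obtain ⟨_, hx'⟩ := h.mem_orbit_purePowers hd (fun i _ => Or.inr ⟨hb, hinv, hres⟩) _
          (fun i => rfl)
        refine Or.inr ⟨Finset.univ.filter fun i => res φ ((weightChar t d (χ i, n i) : Kˣ) *
          b ^ (dehomog (u i).1).natTrailingDegree) ≠ 0, mem_orbit_trans hww' ?_⟩
        simpa only [Finset.mem_filter, Finset.mem_univ, true_and] using hx'
  · have hdO : (d : K) ∈ O := by
      have hunit : IsUnit (⟨_, h.inv_mem⟩ : O) := IsUnit.of_map φ _ (Ne.isUnit hd)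
      obtain ⟨z, hz⟩ := isUnit_iff_exists_inv.1 hunit
      have hz' : (d : K)⁻¹ * z = 1 := congrArg Subtype.val hz
      have := eq_inv_of_mul_eq_one_right hz'
      rw [inv_inv] at this
      exact this ▸ z.2
    obtain ⟨J, hJ⟩ := h.mem_orbit_restrict hdO
    refine Or.inl ⟨J, mem_orbit_trans hww' (mem_orbit_trans hJ ?_)⟩
    refine ⟨(1, unip β * g), funext fun i => ?_⟩
    show rep χ n (1, unip β * g) (restrict J v) i = restrict J u i
    have h0 : ∀ w w' : Space n, w i = w' i →
        rep χ n (1, unip β * g) w i = rep χ n (1, unip β * g) w' i := fun w w' h =>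
      congrArg (simpleRep (χ i) (n i) (1, unip β * g)) h
    by_cases hi : i ∈ J
    · rw [h0 _ v (if_pos hi), restrict, if_pos hi]
    · have h1 : restrict J u i = 0 := if_neg hi
      rw [h1]
      exact (rep_apply_eq_zero_iff _ _ _).2 (if_neg hi)

end Closure

/-! ### Admissible faces -/

section Faces

variable {k s : ℕ} {χ : Fin s → Fin k → ℤ} {n : Fin s → ℕ} {v : Space n}

theorem pairing_add_left (P Q R : (Fin k → ℚ) × ℚ) :
    pairing (P + Q) R = pairing P R + pairing Q R := by
  simp only [pairing, Prod.fst_add, Prod.snd_add, Pi.add_apply, add_mul, Finset.sum_add_distrib]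
  ring

theorem pairing_smul_left (c : ℚ) (P R : (Fin k → ℚ) × ℚ) :
    pairing (c • P) R = c * pairing P R := by
  simp only [pairing, Prod.smul_fst, Prod.smul_snd, Pi.smul_apply, smul_eq_mul, mul_add,
    Finset.mul_sum, mul_assoc]

theorem pairing_comm (P R : (Fin k → ℚ) × ℚ) : pairing P R = pairing R P := by
  simp [pairing, mul_comm]

/-- The hyperplane orthogonal to `R` as a cone. -/
def orthCone (R : (Fin k → ℚ) × ℚ) : PointedCone ℚ ((Fin k → ℚ) × ℚ) where
  carrier := {P | pairing P R = 0}
  add_mem' := fun {P Q} hP hQ => by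
    show pairing (P + Q) R = 0
    rw [pairing_add_left, show pairing P R = 0 from hP, show pairing Q R = 0 from hQ, add_zero]
  zero_mem' := by simp [pairing]
  smul_mem' := fun c P hP => by
    show pairing ((c : ℚ) • P) R = 0
    rw [pairing_smul_left, show pairing P R = 0 from hP, mul_zero]

/-- `R` has negative last coordinate and is nonnegative on the characteristic points. -/
def IsDestabilizing (χ : Fin s → Fin k → ℤ) (v : Space n) (R : (Fin k → ℚ) × ℚ) : Prop :=
  R.2 < 0 ∧ ∀ i, v i ≠ 0 → 0 ≤ pairing (charPoint (χ i) (n i)) R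

open scoped Classical in
/-- The indices of the characteristic points orthogonal to `R`. -/
noncomputable def orthIndices (χ : Fin s → Fin k → ℤ) (v : Space n) (R : (Fin k → ℚ) × ℚ) :
    Finset (Fin s) :=
  {i | v i ≠ 0 ∧ pairing (charPoint (χ i) (n i)) R = 0}

theorem mem_orthIndices {R : (Fin k → ℚ) × ℚ} {i : Fin s} :
    i ∈ orthIndices χ v R ↔ v i ≠ 0 ∧ pairing (charPoint (χ i) (n i)) R = 0 := by
  simp [orthIndices]

theorem charPoint_mem_charCone {i : Fin s} (hi : v i ≠ 0) :
    charPoint (χ i) (n i) ∈ charCone χ v :=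
  Submodule.subset_span ⟨i, hi, rfl⟩

theorem IsDestabilizing.nonneg {R : (Fin k → ℚ) × ℚ} (hR : IsDestabilizing χ v R)
    {P : (Fin k → ℚ) × ℚ} (hP : P ∈ charCone χ v) : 0 ≤ pairing P R := by
  induction hP using Submodule.span_induction with
  | mem P h =>
    obtain ⟨i, hi, rfl⟩ := h
    exact hR.2 i hi
  | zero => simp [pairing]
  | add P Q _ _ hP hQ =>
    rw [pairing_add_left]
    exact add_nonneg hP hQ
  | smul c P _ hP =>
    show 0 ≤ pairing ((c : ℚ) • P) R
    rw [pairing_smul_left]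
    exact mul_nonneg c.2 hP

theorem IsDestabilizing.isFaceOf {R : (Fin k → ℚ) × ℚ} (hR : IsDestabilizing χ v R) :
    (charCone χ v ⊓ orthCone R).IsFaceOf (charCone χ v) where
  le := inf_le_left
  mem_of_smul_add_mem := by
    intro x y a hx hy ha hxy
    refine ⟨hx, ?_⟩
    have h1 : pairing (a • x + y) R = 0 := hxy.2
    rw [pairing_add_left, pairing_smul_left] at h1
    have h2 := hR.nonneg hx
    have h3 := hR.nonneg hy
    have h4 : 0 ≤ a * pairing x R := mul_nonneg ha.le h2
    have h5 : a * pairing x R = 0 := by linarith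
    exact (mul_eq_zero.1 h5).resolve_left ha.ne'

theorem IsDestabilizing.isAdmissibleFace {R : (Fin k → ℚ) × ℚ} (hR : IsDestabilizing χ v R) :
    IsAdmissibleFace χ v (charCone χ v ⊓ orthCone R) :=
  ⟨hR.isFaceOf, R, hR.1, fun _ hP => hP.2,
    fun _ hF hlt horth => hlt.not_ge fun P hP => ⟨hF.le hP, horth P hP⟩, hR.2⟩

/-- The admissible faces are cut out by the hyperplanes orthogonal to destabilizing vectors. -/
theorem IsAdmissibleFace.exists_eq {F : PointedCone ℚ ((Fin k → ℚ) × ℚ)}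
    (hF : IsAdmissibleFace χ v F) :
    ∃ R, IsDestabilizing χ v R ∧ F = charCone χ v ⊓ orthCone R := by
  obtain ⟨hface, R, hp, horth, hmax, hnn⟩ := hF
  have hR : IsDestabilizing χ v R := ⟨hp, hnn⟩
  refine ⟨R, hR, ?_⟩
  have hle : F ≤ charCone χ v ⊓ orthCone R := fun P hP => ⟨hface.le hP, horth P hP⟩
  by_contra hne
  exact hmax _ hR.isFaceOf (lt_of_le_of_ne hle hne) fun P hP => hP.2

theorem faceIndices_inf_orthCone (R : (Fin k → ℚ) × ℚ) :
    faceIndices χ v (charCone χ v ⊓ orthCone R) = orthIndices χ v R := by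
  ext i
  simp only [faceIndices, orthIndices, Finset.mem_filter, Finset.mem_univ, true_and]
  exact and_congr_right fun hi =>
    ⟨fun h => h.2, fun h => ⟨charPoint_mem_charCone hi, h⟩⟩

/-- If `Q` is orthogonal to the characteristic points orthogonal to `R`, but not to all
characteristic points, then moving `R` in the direction of `Q` or of `-Q` until it meets the boundary
of the dual cone enlarges the face. -/
theorem IsDestabilizing.exists_orthIndices_ssubset {R Q : (Fin k → ℚ) × ℚ}
    (hR : IsDestabilizing χ v R) (hQ : Q.2 = 0)
    (hQR : ∀ i ∈ orthIndices χ v R, pairing (charPoint (χ i) (n i)) Q = 0)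
    (hne : ∃ i, v i ≠ 0 ∧ pairing (charPoint (χ i) (n i)) Q ≠ 0) :
    ∃ R', IsDestabilizing χ v R' ∧ orthIndices χ v R ⊂ orthIndices χ v R' := by
  classical
  wlog hneg : ∃ i, v i ≠ 0 ∧ pairing (charPoint (χ i) (n i)) Q < 0 generalizing Q
  · have hpn : ∀ P, pairing P (-Q) = -pairing P Q := fun P => by
      rw [pairing_comm, show -Q = (-1 : ℚ) • Q by simp, pairing_smul_left, pairing_comm]
      ring
    obtain ⟨i, hi, hiQ⟩ := hne
    refine this (Q := -Q) (by simp [hQ]) (fun i hi => by rw [hpn, hQR i hi, neg_zero])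
      ⟨i, hi, by rw [hpn]; exact neg_ne_zero.2 hiQ⟩ ⟨i, hi, ?_⟩
    rw [hpn]
    have : ¬ pairing (charPoint (χ i) (n i)) Q < 0 := fun h => hneg ⟨i, hi, h⟩
    exact neg_neg_of_pos (lt_of_le_of_ne (not_lt.1 this) hiQ.symm)
  set r : Fin s → ℚ := fun i => pairing (charPoint (χ i) (n i)) R with hr
  set q : Fin s → ℚ := fun i => pairing (charPoint (χ i) (n i)) Q with hq
  obtain ⟨i₀, hi₀, hq₀⟩ := hneg
  obtain ⟨i₁, hi₁, hmin⟩ := Finset.exists_min_image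
    (Finset.univ.filter fun i => v i ≠ 0 ∧ q i < 0) (fun i => r i / (-q i)) ⟨i₀, by simp [hi₀, hq₀, hq]⟩
  simp only [Finset.mem_filter, Finset.mem_univ, true_and] at hi₁ hmin
  set c : ℚ := r i₁ / (-q i₁)
  have hc : 0 ≤ c := div_nonneg (hR.2 i₁ hi₁.1) (by linarith [hi₁.2])
  have hR' : ∀ i, pairing (charPoint (χ i) (n i)) (R + c • Q) = r i + c * q i := fun i => by
    rw [pairing_comm, pairing_add_left, pairing_smul_left, pairing_comm R, pairing_comm Q]
  refine ⟨R + c • Q, ⟨?_, fun i hi => ?_⟩, ?_⟩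
  · simpa [hQ] using hR.1
  · rw [hR']
    have hri : 0 ≤ r i := hR.2 i hi
    rcases le_or_gt 0 (q i) with h | h
    · exact add_nonneg hri (mul_nonneg hc h)
    · have := hmin i ⟨hi, h⟩
      rw [le_div_iff₀ (by linarith)] at this
      linarith
  · refine (Finset.ssubset_iff_of_subset fun i hi => ?_).2 ⟨i₁, ?_, fun h => ?_⟩
    · have h0 := mem_orthIndices.1 hi
      refine mem_orthIndices.2 ⟨h0.1, ?_⟩
      rw [hR', show q i = 0 from hQR i hi, show r i = 0 from h0.2, mul_zero, add_zero]
    · refine mem_orthIndices.2 ⟨hi₁.1, ?_⟩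
      rw [hR']
      have : c * (-q i₁) = r i₁ := div_mul_cancel₀ _ (by linarith [hi₁.2])
      linarith
    · exact hi₁.2.ne (hQR i₁ h)

theorem exists_pairing_eq (f : Module.Dual ℚ ((Fin k → ℚ) × ℚ)) :
    ∃ Q, ∀ P, f P = pairing P Q := by
  refine ⟨(fun l => f (Pi.single l 1, 0), f (0, 1)), fun P => ?_⟩
  have hP : P = (∑ l, P.1 l • ((Pi.single l 1, 0) : (Fin k → ℚ) × ℚ)) +
      P.2 • ((0, 1) : (Fin k → ℚ) × ℚ) := by
    refine Prod.ext ?_ ?_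
    · funext l
      simp [Prod.fst_sum, Finset.sum_apply, Pi.single_apply]
    · simp [Prod.snd_sum]
  conv_lhs => rw [hP]
  rw [map_add, map_sum]
  simp only [map_smul, smul_eq_mul, pairing]

/-- A destabilizing vector whose orthogonal face cannot be enlarged defines an admissible face of
maximal dimension. -/
theorem IsDestabilizing.isMaxAdmissibleFace {R : (Fin k → ℚ) × ℚ} (hR : IsDestabilizing χ v R)
    (hmax : ∀ R', IsDestabilizing χ v R' → ¬ orthIndices χ v R ⊂ orthIndices χ v R') :
    IsMaxAdmissibleFace χ v (charCone χ v ⊓ orthCone R) := by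
  refine ⟨hR.isAdmissibleFace, fun F' hF' => ?_⟩
  obtain ⟨R₁, hR₁, rfl⟩ := hF'.exists_eq
  set e : (Fin k → ℚ) × ℚ := (0, 1)
  set U := Submodule.span ℚ ((charCone χ v ⊓ orthCone R : PointedCone ℚ _) :
    Set ((Fin k → ℚ) × ℚ)) with hU
  set U₁ := Submodule.span ℚ ((charCone χ v ⊓ orthCone R₁ : PointedCone ℚ _) :
    Set ((Fin k → ℚ) × ℚ)) with hU₁
  have hmem : ∀ i, v i ≠ 0 → charPoint (χ i) (n i) ∈ U ⊔ Submodule.span ℚ {e} := by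
    intro i hi
    by_contra hnot
    obtain ⟨f, hf, hfle⟩ := Submodule.exists_le_ker_of_notMem hnot
    obtain ⟨Q, hQ⟩ := exists_pairing_eq f
    obtain ⟨R', hR', hlt⟩ := hR.exists_orthIndices_ssubset (Q := Q) (by
        have h1 : f e = 0 := hfle (Submodule.mem_sup_right (Submodule.mem_span_singleton_self e))
        rw [hQ] at h1
        simpa [pairing, e] using h1) (by
        intro l hl
        rw [← hQ]
        have h0 := mem_orthIndices.1 hl
        exact hfle (Submodule.mem_sup_left
          (Submodule.subset_span ⟨charPoint_mem_charCone h0.1, h0.2⟩)))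
      ⟨i, hi, by rw [← hQ]; exact hf⟩
    exact hmax R' hR' hlt
  have hle : U₁ ⊔ Submodule.span ℚ {e} ≤ U ⊔ Submodule.span ℚ {e} := by
    have hcone : ∀ P ∈ charCone χ v, P ∈ U ⊔ Submodule.span ℚ {e} := by
      intro P hP
      induction hP using Submodule.span_induction with
      | mem P h =>
        obtain ⟨i, hi, rfl⟩ := h
        exact hmem i hi
      | zero => exact zero_mem _
      | add P Q _ _ hP hQ => exact add_mem hP hQ
      | smul c P _ hP => exact Submodule.smul_mem _ (c : ℚ) hP
    exact sup_le (Submodule.span_le.2 fun P hP => hcone P hP.1) le_sup_right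
  have hdisj : Disjoint U₁ (Submodule.span ℚ {e}) := by
    rw [Submodule.disjoint_span_singleton' (by simp [e])]
    intro he
    have h1 : ∀ P ∈ U₁, pairing P R₁ = 0 := by
      intro P hP
      induction hP using Submodule.span_induction with
      | mem P h => exact h.2
      | zero => simp [pairing]
      | add P Q _ _ hP hQ => rw [pairing_add_left, hP, hQ, add_zero]
      | smul c P _ hP => rw [pairing_smul_left, hP, mul_zero]
    have h2 := h1 e he
    simp only [pairing, e, Pi.zero_apply, zero_mul, Finset.sum_const_zero, one_mul, zero_add] at h2
    exact hR₁.1.ne h2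
  have h1 := Submodule.finrank_mono hle
  have h2 := Submodule.finrank_sup_add_finrank_inf_eq U₁ (Submodule.span ℚ {e})
  rw [hdisj.eq_bot, finrank_bot] at h2
  have h3 := Submodule.finrank_add_le_finrank_add_finrank U (Submodule.span ℚ {e})
  show Module.finrank ℚ U₁ ≤ Module.finrank ℚ U
  omega

theorem IsDestabilizing.exists_isMaxAdmissibleFace {R : (Fin k → ℚ) × ℚ}
    (hR : IsDestabilizing χ v R) : ∃ R', IsMaxAdmissibleFace χ v (charCone χ v ⊓ orthCone R') ∧
      orthIndices χ v R ⊆ orthIndices χ v R' := by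
  obtain ⟨I, hle, hI⟩ := (Set.toFinite {I | ∃ R', IsDestabilizing χ v R' ∧
    I = orthIndices χ v R'}).exists_le_maximal ⟨R, hR, rfl⟩
  obtain ⟨⟨R', hR', rfl⟩, hmax⟩ := hI
  exact ⟨R', hR'.isMaxAdmissibleFace fun R'' hR'' hlt => hlt.2 (hmax ⟨R'', hR'', rfl⟩ hlt.1), hle⟩

/-- The condition on the admissible faces of maximal dimension implies the same condition on the
face orthogonal to any destabilizing vector. -/
theorem sum_rootMult_eq_zero_of_forall_isMaxAdmissibleFace
    (h : ∀ F : PointedCone ℚ ((Fin k → ℚ) × ℚ), IsMaxAdmissibleFace χ v F →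
      ∀ β : Fin s → ℤ, ∑ i ∈ faceIndices χ v F, β i • χ i = 0 →
        ∀ a : ℂ, ∑ i ∈ faceIndices χ v F, (rootMult (v i) a : ℤ) * β i = 0)
    {R : (Fin k → ℚ) × ℚ} (hR : IsDestabilizing χ v R) (β : Fin s → ℤ)
    (hβ : ∑ i ∈ orthIndices χ v R, β i • χ i = 0) (a : ℂ) :
    ∑ i ∈ orthIndices χ v R, (rootMult (v i) a : ℤ) * β i = 0 := by
  classical
  obtain ⟨R', hR', hsub⟩ := hR.exists_isMaxAdmissibleFace
  have h1 := h _ hR' (fun i => if i ∈ orthIndices χ v R then β i else 0)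
  rw [faceIndices_inf_orthCone] at h1
  simp only [ite_smul, zero_smul, mul_ite, mul_zero, Finset.sum_ite_mem,
    Finset.inter_eq_right.2 hsub] at h1
  exact h1 hβ a

end Faces

/-! ### Monomials in polynomial functions of one variable -/

section Constancy

open Polynomial

variable {ι : Type*} {I : Finset ι} {G : ι → ℂ[X]} {β : ι → ℤ}

/-- The numerator `∏ Gᵢ ^ βᵢ`, over the positive exponents; the denominator is obtained from
the exponents `-β`. -/
noncomputable def posPart (I : Finset ι) (G : ι → ℂ[X]) (β : ι → ℤ) : ℂ[X] :=
  ∏ i ∈ I, G i ^ (β i).toNat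

theorem posPart_ne_zero (hG : ∀ i ∈ I, G i ≠ 0) : posPart I G β ≠ 0 :=
  Finset.prod_ne_zero_iff.2 fun i hi => pow_ne_zero _ (hG i hi)

theorem eval_posPart_div {x : ℂ} (hx : ∀ i ∈ I, (G i).eval x ≠ 0) :
    (posPart I G β).eval x = (∏ i ∈ I, (G i).eval x ^ β i) * (posPart I G (-β)).eval x := by
  simp only [posPart, eval_prod, eval_pow]
  rw [← Finset.prod_mul_distrib]
  refine Finset.prod_congr rfl fun i hi => ?_
  rw [← zpow_natCast, ← zpow_natCast, ← zpow_add₀ (hx i hi)]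
  congr 1
  simp only [Pi.neg_apply]
  omega

theorem rootMultiplicity_posPart (hG : ∀ i ∈ I, G i ≠ 0) (a : ℂ) :
    (posPart I G β).rootMultiplicity a = ∑ i ∈ I, (β i).toNat * (G i).rootMultiplicity a := by
  classical
  rw [← count_roots, posPart, roots_prod _ _ (posPart_ne_zero hG), Multiset.count_bind,
    Finset.sum_map_val]
  simp [roots_pow]

theorem sum_mul_rootMultiplicity (hG : ∀ i ∈ I, G i ≠ 0) (a : ℂ) :
    ∑ i ∈ I, ((G i).rootMultiplicity a : ℤ) * β i =
      (posPart I G β).rootMultiplicity a - (posPart I G (-β)).rootMultiplicity a := by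
  rw [rootMultiplicity_posPart hG, rootMultiplicity_posPart hG]
  push_cast
  rw [← Finset.sum_sub_distrib]
  refine Finset.sum_congr rfl fun i _ => ?_
  rw [← sub_mul, mul_comm]
  congr 1
  simp only [Pi.neg_apply]
  omega

/-- If the zeros and poles of `∏ Gᵢ ^ βᵢ` cancel, this function is constant. -/
theorem prod_eval_zpow_eq (hG : ∀ i ∈ I, G i ≠ 0)
    (h : ∀ a, ∑ i ∈ I, ((G i).rootMultiplicity a : ℤ) * β i = 0) {x y : ℂ}
    (hx : ∀ i ∈ I, (G i).eval x ≠ 0) (hy : ∀ i ∈ I, (G i).eval y ≠ 0) :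
    ∏ i ∈ I, (G i).eval x ^ β i = ∏ i ∈ I, (G i).eval y ^ β i := by
  classical
  set P := posPart I G β
  set Q := posPart I G (-β)
  have hroots : P.roots = Q.roots := by
    ext a
    rw [count_roots, count_roots]
    have := sum_mul_rootMultiplicity (β := β) hG a
    rw [h a] at this
    have : (P.rootMultiplicity a : ℤ) = Q.rootMultiplicity a := by linarith
    exact_mod_cast this
  have hP : P = C P.leadingCoeff * (P.roots.map fun a => X - C a).prod :=
    (IsAlgClosed.splits P).eq_prod_roots
  have hQ : Q = C Q.leadingCoeff * (Q.roots.map fun a => X - C a).prod :=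
    (IsAlgClosed.splits Q).eq_prod_roots
  have hPQ : C Q.leadingCoeff * P = C P.leadingCoeff * Q := by
    conv_lhs => rw [hP, hroots]
    conv_rhs => rw [hQ]
    ring
  have hlQ : Q.leadingCoeff ≠ 0 := leadingCoeff_ne_zero.2 (posPart_ne_zero hG)
  have key : ∀ z, (∀ i ∈ I, (G i).eval z ≠ 0) →
      ∏ i ∈ I, (G i).eval z ^ β i = P.leadingCoeff / Q.leadingCoeff := by
    intro z hz
    have h1 := congrArg (eval z) hPQ
    rw [eval_mul, eval_mul, eval_C, eval_C, eval_posPart_div hz] at h1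
    have h2 : Q.eval z ≠ 0 := by
      simp only [Q, posPart, eval_prod, eval_pow]
      exact Finset.prod_ne_zero_iff.2 fun i hi => pow_ne_zero _ (hz i hi)
    rw [eq_div_iff hlQ]
    apply mul_right_cancel₀ h2
    rw [← h1]
    ring
  rw [key x hx, key y hy]

/-- If `∏ Gᵢ ^ βᵢ` takes some value infinitely often, it is constant, and its zeros and poles
cancel. -/
theorem sum_rootMultiplicity_eq_zero_of_infinite (hG : ∀ i ∈ I, G i ≠ 0) (c : ℂ)
    (h : {x | (∀ i ∈ I, (G i).eval x ≠ 0) ∧ ∏ i ∈ I, (G i).eval x ^ β i = c}.Infinite) (a : ℂ) :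
    ∑ i ∈ I, ((G i).rootMultiplicity a : ℤ) * β i = 0 := by
  have hPQ : posPart I G β = C c * posPart I G (-β) := by
    refine eq_of_infinite_eval_eq _ _ (h.mono fun x hx => ?_)
    show eval x _ = eval x _
    rw [eval_posPart_div hx.1, hx.2, eval_mul, eval_C]
  have hc : c ≠ 0 := by
    rintro rfl
    rw [C_0, zero_mul] at hPQ
    exact posPart_ne_zero hG hPQ
  rw [sum_mul_rootMultiplicity hG, hPQ, rootMultiplicity_mul
    (mul_ne_zero (C_ne_zero.2 hc) (posPart_ne_zero hG)), rootMultiplicity_C, zero_add, sub_self]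

end Constancy

/-! ### Finiteness of the number of orbits -/

section Sufficiency

variable {k s : ℕ} {χ : Fin s → Fin k → ℤ} {n : Fin s → ℕ} {v : Space n}

theorem limitPoint_eq (R : (Fin k → ℚ) × ℚ) (β : ℂ) : limitPoint χ v R β =
    purePowers fun i => if i ∈ orthIndices χ v R then (dehomog (v i).1).eval β else 0 := by
  classical
  simp only [limitPoint, mem_orthIndices]

/-- On the hyperplane orthogonal to `R`, a relation between the characters `χᵢ` is a relation between
the characteristic points, because the last coordinate of `R` is nonzero. -/
theorem eq_zero_of_sum_zsmul_eq_zero {R : (Fin k → ℚ) × ℚ} (hR : IsDestabilizing χ v R)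
    {β : Fin s → ℤ} (hβ : ∑ i ∈ orthIndices χ v R, β i • χ i = 0) :
    ∑ i ∈ orthIndices χ v R, β i • ((χ i, (n i : ℤ)) : (Fin k → ℤ) × ℤ) = 0 := by
  refine Prod.ext (by simpa [Prod.fst_sum] using hβ) ?_
  have h1 : ∑ i ∈ orthIndices χ v R, (β i : ℚ) * pairing (charPoint (χ i) (n i)) R = 0 :=
    Finset.sum_eq_zero fun i hi => by rw [(mem_orthIndices.1 hi).2, mul_zero]
  have h2 : ∀ l, ∑ i ∈ orthIndices χ v R, (β i : ℚ) * χ i l = 0 := by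
    intro l
    have := congrFun hβ l
    simp only [Finset.sum_apply, Pi.smul_apply, smul_eq_mul, Pi.zero_apply] at this
    exact_mod_cast this
  have h3 : (∑ i ∈ orthIndices χ v R, (β i : ℚ) * n i) * R.2 = 0 := by
    rw [← h1]
    simp only [pairing, charPoint, mul_add, Finset.mul_sum, Finset.sum_add_distrib]
    rw [Finset.sum_comm, Finset.sum_mul]
    have : ∑ l, ∑ i ∈ orthIndices χ v R, (β i : ℚ) * (χ i l * R.1 l) = 0 := by
      refine Finset.sum_eq_zero fun l _ => ?_
      rw [← zero_mul (R.1 l), ← h2 l, Finset.sum_mul]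
      exact Finset.sum_congr rfl fun i _ => by ring
    rw [this, zero_add]
    exact Finset.sum_congr rfl fun i _ => by ring
  have h4 := (mul_eq_zero.1 h3).resolve_right hR.1.ne
  rw [Prod.snd_sum]
  simp only [Prod.smul_snd, smul_eq_mul, Prod.snd_zero]
  exact_mod_cast h4

/-- If the torus-invariant monomials in the coefficients are constant, the limits of any two generic
translates along `R` lie in the same orbit. -/
theorem limitPoint_mem_orbit {R : (Fin k → ℚ) × ℚ}
    (h : ∀ β : Fin s → ℤ, ∑ i ∈ orthIndices χ v R, β i • χ i = 0 →
      ∀ a : ℂ, ∑ i ∈ orthIndices χ v R, (rootMult (v i) a : ℤ) * β i = 0) {x y : ℂ}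
    (hx : ∀ i, v i ≠ 0 → (dehomog (v i).1).eval x ≠ 0)
    (hy : ∀ i, v i ≠ 0 → (dehomog (v i).1).eval y ≠ 0) :
    limitPoint χ v R x ∈ orbit χ n (limitPoint χ v R y) := by
  classical
  set I := orthIndices χ v R with hI
  have hIv : ∀ i ∈ I, v i ≠ 0 := fun i hi => (mem_orthIndices.1 hi).1
  have hcoeff : ∀ z i l, (dehomog (limitPoint χ v R z i).1).coeff l =
      if i ∈ I ∧ l = 0 then (dehomog (v i).1).eval z else 0 := by
    intro z i l
    rw [limitPoint_eq, dehomog_purePowers, Polynomial.coeff_C, ite_and]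
    by_cases hi : i ∈ I
    · simp [hi, ← hI]
    · simp [hi, ← hI]
  refine mem_orbit_of_coeff
    (fun i _ => (dehomog (v i).1).eval x / (dehomog (v i).1).eval y) ?_ ?_ ?_
  · intro i l
    rw [hcoeff, hcoeff]
    by_cases hi : i ∈ I ∧ l = 0
    · rw [if_pos hi, if_pos hi, div_mul_cancel₀ _ (hy i (hIv i hi.1))]
    · rw [if_neg hi, if_neg hi, mul_zero]
  · intro i l hne
    rw [hcoeff] at hne
    have hi : i ∈ I := by
      by_contra hi
      exact hne (if_neg fun h => hi h.1)
    exact div_ne_zero (hx i (hIv i hi)) (hy i (hIv i hi))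
  · intro β hβ
    have hmem : ∀ p : {p : Σ i, Fin (n i + 1) //
        (dehomog (limitPoint χ v R y p.1).1).coeff p.2 ≠ 0}, p.1.1 ∈ I ∧ (p.1.2 : ℕ) = 0 := by
      intro p
      have := p.2
      rw [hcoeff] at this
      by_contra hno
      exact this (if_neg hno)
    -- the exponents regrouped by the components
    let b : Fin s → ℤ := fun i => ∑ p with p.1.1 = i, β p
    have hsum : ∑ i ∈ I, b i • χ i = 0 := by
      have h1 := congrArg Prod.fst hβ
      rw [Prod.fst_sum] at h1
      simp only [Prod.smul_fst, Prod.fst_zero] at h1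
      rw [← h1, ← Finset.sum_fiberwise_of_maps_to (s := Finset.univ) (t := I)
        (g := fun p => p.1.1) (fun p _ => (hmem p).1)]
      refine Finset.sum_congr rfl fun i _ => ?_
      rw [Finset.sum_smul]
      exact Finset.sum_congr rfl fun p hp => by rw [(Finset.mem_filter.1 hp).2]
    have hmul := h b hsum
    have hc := prod_eval_zpow_eq (I := I) (G := fun i => dehomog (v i).1) (β := b)
      (fun i hi => dehomog_ne_zero (hIv i hi)) (fun a => by
        rw [← hmul (-a)]
        exact Finset.sum_congr rfl fun i hi => by rw [rootMult_eq (hIv i hi), neg_neg])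
      (fun i hi => hx i (hIv i hi)) (fun i hi => hy i (hIv i hi))
    rw [← Finset.prod_fiberwise_of_maps_to (s := Finset.univ) (t := I)
        (g := fun p => p.1.1) (fun p _ => (hmem p).1)]
    have hfib : ∀ i ∈ I, (∏ p with p.1.1 = i, ((dehomog (v p.1.1).1).eval x /
        (dehomog (v p.1.1).1).eval y) ^ β p) =
          (dehomog (v i).1).eval x ^ b i / (dehomog (v i).1).eval y ^ b i := by
      intro i hi
      rw [← div_zpow, ← prod_zpow_eq_zpow_sum₀ _
        (div_ne_zero (hx i (hIv i hi)) (hy i (hIv i hi)))]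
      exact Finset.prod_congr rfl fun p hp => by rw [(Finset.mem_filter.1 hp).2]
    rw [Finset.prod_congr rfl hfib, Finset.prod_div_distrib, hc, div_self]
    exact Finset.prod_ne_zero_iff.2 fun i hi => zpow_ne_zero _ (hy i (hIv i hi))

/-- The condition on the faces orthogonal to all destabilizing vectors suffices for finiteness. -/
theorem finite_orbits_of_forall
    (h : ∀ R, IsDestabilizing χ v R → ∀ β : Fin s → ℤ,
      ∑ i ∈ orthIndices χ v R, β i • χ i = 0 →
        ∀ a : ℂ, ∑ i ∈ orthIndices χ v R, (rootMult (v i) a : ℤ) * β i = 0) :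
    {O : Set (Space n) | (∃ w, O = orbit χ n w) ∧ O ⊆ zariskiClosure (orbit χ n v)}.Finite := by
  classical
  let A : Set (Set (Space n)) := Set.range fun J => orbit χ n (restrict J v)
  let B : Finset (Fin s) → Set (Set (Space n)) := fun I => {O | ∃ R β, IsDestabilizing χ v R ∧
    (∀ i, v i ≠ 0 → (dehomog (v i).1).eval β ≠ 0) ∧ orthIndices χ v R = I ∧
      O = orbit χ n (limitPoint χ v R β)}
  let D : Space n → Set (Set (Space n)) := fun u =>
    (Set.range fun J => orbit χ n (selectTerms J u)) ∪ Set.range fun J : Finset (Fin s) =>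
      orbit χ n (purePowers fun i => if i ∈ J then (dehomog (u i).1).trailingCoeff else 0)
  have hB : ∀ I, (B I).Finite := by
    intro I
    refine Set.Subsingleton.finite ?_
    rintro _ ⟨R, x, hR, hx, rfl, rfl⟩ _ ⟨R', y, _, hy, hI, rfl⟩
    have : limitPoint χ v R' y = limitPoint χ v R y := by rw [limitPoint_eq, limitPoint_eq, hI]
    rw [this]
    exact orbit_eq_of_mem (limitPoint_mem_orbit (h R hR) hx hy)
  have hD : ∀ u, (D u).Finite := fun u => (Set.finite_range _).union (Set.finite_range _)
  refine (((Set.finite_range _).union (Set.finite_iUnion hB)).union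
    ((finite_exceptionalTranslates (χ := χ) v).biUnion fun u _ => hD u) :
      (A ∪ (⋃ I, B I) ∪ ⋃ u ∈ exceptionalTranslates χ v, D u).Finite).subset ?_
  rintro O ⟨⟨w, rfl⟩, hO⟩
  rcases mem_zariskiClosure_cases (hO (mem_orbit_self w)) with
    ⟨J, hJ⟩ | ⟨R, β, hR, hRi, hβ, hw⟩ | ⟨u, hu, ⟨J, hJ⟩ | ⟨J, hJ⟩⟩
  · exact Or.inl (Or.inl ⟨J, (orbit_eq_of_mem hJ).symm⟩)
  · exact Or.inl (Or.inr (Set.mem_iUnion.2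
      ⟨orthIndices χ v R, R, β, ⟨hR, hRi⟩, hβ, rfl, orbit_eq_of_mem hw⟩))
  · exact Or.inr (Set.mem_biUnion hu (Or.inl ⟨J, (orbit_eq_of_mem hJ).symm⟩))
  · exact Or.inr (Set.mem_biUnion hu (Or.inr ⟨J, (orbit_eq_of_mem hJ).symm⟩))

end Sufficiency

/-! ### Limit points and the necessity of the condition -/

section Necessity

open Polynomial

theorem exists_polynomial_of_mem_polyFun {V : Type*} [AddCommGroup V] [Module ℂ V] {γ : ℂ → V}
    (hγ : ∀ f : Module.Dual ℂ V, ∃ p : ℂ[X], ∀ z, f (γ z) = p.eval z) {f : V → ℂ}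
    (hf : f ∈ polyFun V) : ∃ p : ℂ[X], ∀ z, f (γ z) = p.eval z := by
  induction hf using Algebra.adjoin_induction with
  | mem f hf =>
    obtain ⟨φ, rfl⟩ := hf
    exact hγ φ
  | algebraMap c => exact ⟨C c, fun z => by simp⟩
  | add f g _ _ hf hg =>
    obtain ⟨p, hp⟩ := hf
    obtain ⟨q, hq⟩ := hg
    exact ⟨p + q, fun z => by simp [hp, hq]⟩
  | mul f g _ _ hf hg =>
    obtain ⟨p, hp⟩ := hf
    obtain ⟨q, hq⟩ := hg
    exact ⟨p * q, fun z => by simp [hp, hq]⟩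

/-- The limit at `0` of a polynomial curve lies in the Zariski closure of a set containing the rest of
the curve. -/
theorem mem_zariskiClosure_of_curve {V : Type*} [AddCommGroup V] [Module ℂ V] {S : Set V}
    {γ : ℂ → V} (hγ : ∀ f : Module.Dual ℂ V, ∃ p : ℂ[X], ∀ z, f (γ z) = p.eval z)
    (hS : ∀ z, z ≠ 0 → γ z ∈ S) : γ 0 ∈ zariskiClosure S := by
  intro f hf hfS
  obtain ⟨p, hp⟩ := exists_polynomial_of_mem_polyFun hγ hf
  have h0 : p = 0 := by
    refine eq_zero_of_infinite_isRoot p ((Set.infinite_of_finite_compl (s := {z : ℂ | z ≠ 0})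
      ?_).mono fun z hz => ?_)
    · have : {z : ℂ | z ≠ 0}ᶜ = {0} := by ext z; simp
      rw [this]
      exact Set.finite_singleton 0
    · show p.eval z = 0
      rw [← hp, hfS _ (hS z hz)]
  rw [hp, h0, eval_zero]

theorem comp_mem_polyFun {V : Type*} [AddCommGroup V] [Module ℂ V] {f : V → ℂ}
    (hf : f ∈ polyFun V) (T : V →ₗ[ℂ] V) : (fun x => f (T x)) ∈ polyFun V := by
  induction hf using Algebra.adjoin_induction with
  | mem f hf =>
    obtain ⟨φ, rfl⟩ := hf
    exact Algebra.subset_adjoin ⟨φ.comp T, rfl⟩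
  | algebraMap c => exact (polyFun V).algebraMap_mem c
  | add f g _ _ hf hg => exact (polyFun V).add_mem hf hg
  | mul f g _ _ hf hg => exact (polyFun V).mul_mem hf hg

variable {k s : ℕ} {χ : Fin s → Fin k → ℤ} {n : Fin s → ℕ} {v : Space n}

theorem orbit_subset_zariskiClosure {w : Space n} (hw : w ∈ zariskiClosure (orbit χ n v)) :
    orbit χ n w ⊆ zariskiClosure (orbit χ n v) := by
  rintro _ ⟨g, rfl⟩ f hf hfv
  refine hw (fun x => f (rep χ n g x)) (comp_mem_polyFun hf _) fun u hu => hfv _ ?_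
  exact mem_orbit_trans (rep_mem_orbit g u) hu

/-- The vector with the terms of `u` scaled by powers of `z` with the given exponents. -/
noncomputable def scaleTerms (E : Fin s → ℕ → ℕ) (u : Space n) (z : ℂ) : Space n :=
  fun i => ∑ l ∈ Finset.range (n i + 1),
    z ^ E i l • ofPoly (n i) (monomial l ((dehomog (u i).1).coeff l))

theorem coeff_scaleTerms (E : Fin s → ℕ → ℕ) (u : Space n) (z : ℂ) (i : Fin s) (l : ℕ) :
    (dehomog (scaleTerms E u z i).1).coeff l = z ^ E i l * (dehomog (u i).1).coeff l := by
  by_cases hl : l ≤ n i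
  · have h1 : (scaleTerms E u z i).1 = ∑ m ∈ Finset.range (n i + 1),
        z ^ E i m • (ofPoly (n i) (monomial m ((dehomog (u i).1).coeff m))).1 := by
      simp [scaleTerms]
    rw [h1, map_sum, finsetSum_coeff, Finset.sum_eq_single l]
    · rw [map_smul, dehomog_ofPoly ((natDegree_monomial_le _).trans hl), coeff_smul,
        coeff_monomial, if_pos rfl, smul_eq_mul]
    · intro m hm hml
      rw [map_smul, dehomog_ofPoly ((natDegree_monomial_le _).trans
        (Nat.lt_succ_iff.1 (Finset.mem_range.1 hm))), coeff_smul, coeff_monomial, if_neg hml,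
        smul_zero]
    · intro h
      exact absurd (Finset.mem_range.2 (Nat.lt_succ_of_le hl)) h
  · rw [coeff_dehomog_eq_zero _ (by omega), coeff_dehomog_eq_zero _ (by omega), mul_zero]

theorem dual_scaleTerms (E : Fin s → ℕ → ℕ) (u : Space n) (f : Module.Dual ℂ (Space n)) :
    ∃ p : ℂ[X], ∀ z, f (scaleTerms E u z) = p.eval z := by
  classical
  refine ⟨∑ i, ∑ l ∈ Finset.range (n i + 1), C (f (LinearMap.single ℂ (fun i => BinaryForm (n i)) i
    (ofPoly (n i) (monomial l ((dehomog (u i).1).coeff l))))) * X ^ E i l, fun z => ?_⟩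
  have h1 : scaleTerms E u z = ∑ i, LinearMap.single ℂ (fun i => BinaryForm (n i)) i
      (scaleTerms E u z i) := (Finset.univ_sum_single _).symm
  rw [h1, map_sum, eval_finsetSum]
  refine Finset.sum_congr rfl fun i _ => ?_
  rw [scaleTerms, map_sum, map_sum, eval_finsetSum]
  refine Finset.sum_congr rfl fun l _ => ?_
  rw [map_smul, map_smul, eval_mul, eval_C, eval_pow, eval_X, smul_eq_mul, mul_comm]

theorem exists_integral_multiple {k : ℕ} (R : (Fin k → ℚ) × ℚ) :
    ∃ (N : ℕ) (r : Fin k → ℤ) (p : ℤ), 0 < N ∧ (∀ l, (r l : ℚ) = N * R.1 l) ∧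
      (p : ℚ) = N * R.2 := by
  obtain ⟨⟨b, hb⟩, hbR⟩ := IsLocalization.exist_integer_multiples_of_finite
    (nonZeroDivisors ℤ) (fun o : Option (Fin k) => o.elim R.2 R.1)
  have hb0 : b ≠ 0 := nonZeroDivisors.ne_zero hb
  choose z hz using hbR
  simp only [algebraMap_int_eq, eq_intCast] at hz
  refine ⟨b.natAbs, fun l => b.sign * z (some l), b.sign * z none, Int.natAbs_pos.2 hb0, ?_, ?_⟩
  · intro l
    push_cast
    rw [hz (some l)]
    show (b.sign : ℚ) * (b • R.1 l) = _
    rw [zsmul_eq_mul, ← mul_assoc, ← Int.cast_mul, Int.sign_mul_self_eq_natAbs, Int.cast_natCast]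
  · push_cast
    rw [hz none]
    show (b.sign : ℚ) * (b • R.2) = _
    rw [zsmul_eq_mul, ← mul_assoc, ← Int.cast_mul, Int.sign_mul_self_eq_natAbs, Int.cast_natCast]

theorem weightChar_zpow {k : ℕ} {H : Type*} [CommGroup H] (z : H) (r : Fin k → ℤ) (p : ℤ)
    (P : (Fin k → ℤ) × ℤ) :
    weightChar (fun l => z ^ r l) (z ^ p) P = z ^ (∑ l, P.1 l * r l + P.2 * p) := by
  rw [weightChar, zpow_add, mul_comm P.2, zpow_mul]
  congr 1
  have : ∀ S : Finset (Fin k), ∏ l ∈ S, (z ^ r l) ^ P.1 l = z ^ ∑ l ∈ S, P.1 l * r l := by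
    classical
    intro S
    induction S using Finset.induction_on with
    | empty => simp
    | insert l S hl ih =>
      rw [Finset.prod_insert hl, Finset.sum_insert hl, zpow_add, ih, mul_comm (P.1 l), zpow_mul]
  exact this _

/-- An integral multiple of `R` defines a one-parameter subgroup, along which the translate of `v` by
`unip x` converges to the limit point: the coefficient of `x ^ n i` in the `i`-th component has weight
`⟨(χᵢ, nᵢ), R⟩ ≥ 0`, and the weights of the other terms are larger because the last coordinate of `R`
is negative. -/
theorem limitPoint_mem_zariskiClosure {R : (Fin k → ℚ) × ℚ} (hR : IsDestabilizing χ v R) (x : ℂ) :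
    limitPoint χ v R x ∈ zariskiClosure (orbit χ n v) := by
  classical
  obtain ⟨N, r, p, hN, hr, hp⟩ := exists_integral_multiple R
  have hp0 : p < 0 := by
    have : (p : ℚ) < 0 := by
      rw [hp]
      exact mul_neg_of_pos_of_neg (by exact_mod_cast hN) hR.1
    exact_mod_cast this
  set u := rep χ n (1, unip x) v with hu
  -- the weight of the term `x ^ (n i - l) * y ^ l` of the `i`-th component
  let e : Fin s → ℕ → ℤ := fun i l => ∑ m, χ i m * r m + ((n i : ℤ) - 2 * l) * p
  have he0 : ∀ i, (e i 0 : ℚ) = N * pairing (charPoint (χ i) (n i)) R := by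
    intro i
    simp only [e, pairing, charPoint]
    push_cast
    simp only [hr, hp, mul_add, Finset.mul_sum]
    congr 1
    · exact Finset.sum_congr rfl fun l _ => by ring
    · ring
  have hNpos : (0 : ℚ) < N := by exact_mod_cast hN
  have he0nn : ∀ i, v i ≠ 0 → 0 ≤ e i 0 := by
    intro i hi
    have : (0 : ℚ) ≤ e i 0 := by
      rw [he0]
      exact mul_nonneg hNpos.le (hR.2 i hi)
    exact_mod_cast this
  have hel : ∀ i l, e i l = e i 0 - 2 * l * p := by
    intro i l
    simp only [e]
    push_cast
    ring
  have hnn : ∀ i l, v i ≠ 0 → 0 ≤ e i l := by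
    intro i l hi
    rw [hel]
    have h1 := he0nn i hi
    have h2 : (l : ℤ) * p ≤ 0 := mul_nonpos_of_nonneg_of_nonpos (by positivity) hp0.le
    linarith
  let γ : ℂ → Space n := scaleTerms (fun i l => (e i l).toNat) u
  have hγ0 : γ 0 = limitPoint χ v R x := by
    refine funext fun i => ext_dehomog (Polynomial.ext fun l => ?_)
    rw [coeff_scaleTerms, limitPoint_eq, dehomog_purePowers]
    by_cases hi : v i = 0
    · have h1 : u i = 0 := (rep_apply_eq_zero_iff _ _ _).2 hi
      rw [if_neg fun h => (mem_orthIndices.1 h).1 hi]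
      simp [h1]
    · have h1 := he0nn i hi
      rcases Nat.eq_zero_or_pos l with rfl | hl
      · rw [coeff_C_zero, hu, coeff_zero_dehomog_rep_unip]
        by_cases h0 : e i 0 = 0
        · have h2 : pairing (charPoint (χ i) (n i)) R = 0 := by
            have := he0 i
            rw [h0, Int.cast_zero] at this
            exact (mul_eq_zero.1 this.symm).resolve_left hNpos.ne'
          rw [if_pos (mem_orthIndices.2 ⟨hi, h2⟩), h0]
          simp
        · rw [if_neg, zero_pow (by omega), zero_mul]
          intro h2
          apply h0
          have := he0 i
          rw [(mem_orthIndices.1 h2).2, mul_zero] at this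
          exact_mod_cast this
      · rw [coeff_C_of_ne_zero hl.ne', zero_pow, zero_mul]
        have h2 : 0 < (l : ℤ) * -p := mul_pos (by exact_mod_cast hl) (by linarith)
        have h3 : 0 < e i l := by
          rw [hel]
          linarith
        omega
  rw [← hγ0]
  refine mem_zariskiClosure_of_curve (dual_scaleTerms _ u) fun z hz => ?_
  have h1 : γ z = rep χ n (fun l => Units.mk0 z hz ^ r l, diagTorus (Units.mk0 z hz ^ p)) u := by
    refine funext fun i => ext_dehomog (Polynomial.ext fun l => ?_)
    rw [coeff_scaleTerms, coeff_rep_diagTorus, weightChar_zpow]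
    by_cases hi : v i = 0
    · have h1 : u i = 0 := (rep_apply_eq_zero_iff _ _ _).2 hi
      simp [h1]
    · congr 1
      rw [Units.val_zpow_eq_zpow_val, Units.val_mk0, ← zpow_natCast, Int.toNat_of_nonneg (hnn i l hi)]
  show γ z ∈ _
  rw [h1]
  exact mem_orbit_trans (rep_mem_orbit _ _) (rep_mem_orbit _ _)

theorem coeff_zero_dehomog_linSubst (A : Matrix (Fin 2) (Fin 2) ℂ) (m : ℕ) (c : ℂ) :
    (dehomog (linSubst A (ofPoly m (C c)).1)).coeff 0 = A 0 0 ^ m * c := by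
  have h1 : (ofPoly m (C c)).1 = MvPolynomial.C c * MvPolynomial.X 0 ^ m := by
    refine dehomog_injective (n := m) (ofPoly m (C c)).2 ?_ ?_
    · exact MvPolynomial.isHomogeneous_C_mul_X_pow c 0 m
    · rw [dehomog_ofPoly (by simp), dehomog_C_mul]
      simp [dehomog]
  have h2 : linSubst A (MvPolynomial.C c * MvPolynomial.X 0 ^ m) = MvPolynomial.C c *
      (MvPolynomial.C (A 0 0) * MvPolynomial.X 0 + MvPolynomial.C (A 1 0) * MvPolynomial.X 1) ^ m := by
    rw [map_mul, map_pow, ← MvPolynomial.algebraMap_eq, AlgHom.commutes]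
    simp [linSubst]
  rw [h1, h2, dehomog_C_mul, coeff_C_mul, map_pow, coeff_zero_eq_eval_zero, eval_pow]
  simp [dehomog]
  ring

/-- The monomials in the coefficients of a limit point which are invariant under the torus are
invariants of its orbit. -/
theorem prod_eval_eq_of_limitPoint_mem_orbit {R : (Fin k → ℚ) × ℚ} (hR : IsDestabilizing χ v R)
    {β : Fin s → ℤ} (hβ : ∑ i ∈ orthIndices χ v R, β i • χ i = 0) {x y : ℂ}
    (hx : ∀ i ∈ orthIndices χ v R, (dehomog (v i).1).eval x ≠ 0)
    (h : limitPoint χ v R x ∈ orbit χ n (limitPoint χ v R y)) :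
    ∏ i ∈ orthIndices χ v R, (dehomog (v i).1).eval x ^ β i =
      ∏ i ∈ orthIndices χ v R, (dehomog (v i).1).eval y ^ β i := by
  obtain ⟨⟨t, A⟩, htA⟩ := h
  have h1 : ∀ i ∈ orthIndices χ v R, (dehomog (v i).1).eval x =
      character (χ i) t * (A.1 0 0 ^ n i * (dehomog (v i).1).eval y) := by
    intro i hi
    have h2 := congrArg (fun w : Space n => (dehomog (w i).1).coeff 0) htA
    simp only [limitPoint_eq] at h2
    rw [coe_rep, dehomog_C_mul, coeff_C_mul, purePowers, coeff_zero_dehomog_linSubst,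
      dehomog_purePowers, coeff_C_zero] at h2
    simp only [if_pos hi] at h2
    exact h2.symm
  -- If `A 0 0` vanishes, the degrees of all components involved are zero.
  obtain ⟨d, hd⟩ : ∃ d : ℂˣ, ∀ i ∈ orthIndices χ v R, A.1 0 0 ^ n i = (d : ℂ) ^ n i := by
    by_cases hA : A.1 0 0 = 0
    · refine ⟨1, fun i hi => ?_⟩
      have h3 := hx i hi
      rw [h1 i hi, hA] at h3
      have : n i = 0 := by
        by_contra hn
        apply h3
        rw [zero_pow hn, zero_mul, mul_zero]
      rw [this, pow_zero, pow_zero]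
    · exact ⟨Units.mk0 _ hA, fun i _ => rfl⟩
  have h4 : ∏ i ∈ orthIndices χ v R, ((weightChar t d (χ i, n i) : ℂˣ) : ℂ) ^ β i = 1 := by
    have h5 := weightChar_sum_zsmul t d (orthIndices χ v R) β (fun i => (χ i, (n i : ℤ)))
    rw [eq_zero_of_sum_zsmul_eq_zero hR hβ, weightChar_zero] at h5
    have h6 := congrArg Units.val h5
    push_cast at h6
    exact h6.symm
  rw [← one_mul (∏ i ∈ _, eval y _ ^ β i), ← h4, ← Finset.prod_mul_distrib]
  refine Finset.prod_congr rfl fun i hi => ?_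
  rw [← mul_zpow, h1 i hi, hd i hi, ← mul_assoc]
  congr 2

/-- If there are finitely many orbits, infinitely many limit points of generic translates along `R`
lie in one of them, so the invariant monomials take some value infinitely often. -/
theorem sum_rootMult_eq_zero_of_finite
    (hfin : {O : Set (Space n) | (∃ w, O = orbit χ n w) ∧
      O ⊆ zariskiClosure (orbit χ n v)}.Finite)
    {R : (Fin k → ℚ) × ℚ} (hR : IsDestabilizing χ v R) (β : Fin s → ℤ)
    (hβ : ∑ i ∈ orthIndices χ v R, β i • χ i = 0) (a : ℂ) :
    ∑ i ∈ orthIndices χ v R, (rootMult (v i) a : ℤ) * β i = 0 := by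
  classical
  set I := orthIndices χ v R with hI
  have hIv : ∀ i ∈ I, v i ≠ 0 := fun i hi => (mem_orthIndices.1 hi).1
  let Gen : Set ℂ := {x | ∀ i ∈ I, (dehomog (v i).1).eval x ≠ 0}
  have hGen : Gen.Infinite := by
    refine Set.infinite_of_finite_compl (Set.Finite.subset
      (Set.Finite.biUnion I.finite_toSet fun i _ =>
        (dehomog (v i).1).roots.finite_toSet) fun x hx => ?_)
    simp only [Gen, Set.mem_compl_iff, Set.mem_ofPred_eq, not_forall, not_not] at hx
    obtain ⟨i, hi, h0⟩ := hx
    exact Set.mem_biUnion hi ((mem_roots (dehomog_ne_zero (hIv i hi))).2 h0)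
  obtain ⟨O, -, hO⟩ : ∃ O ∈ {O : Set (Space n) | (∃ w, O = orbit χ n w) ∧
      O ⊆ zariskiClosure (orbit χ n v)},
      {x ∈ Gen | orbit χ n (limitPoint χ v R x) = O}.Infinite := by
    by_contra! hno
    refine hGen ((hfin.biUnion fun O hO => hno O hO).subset fun x hx => ?_)
    exact Set.mem_biUnion ⟨⟨_, rfl⟩,
      orbit_subset_zariskiClosure (limitPoint_mem_zariskiClosure hR x)⟩ ⟨hx, rfl⟩
  obtain ⟨y, -, hyO⟩ := hO.nonempty
  have hinf := sum_rootMultiplicity_eq_zero_of_infinite (I := I)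
    (G := fun i => dehomog (v i).1) (β := β) (fun i hi => dehomog_ne_zero (hIv i hi))
    (∏ i ∈ I, (dehomog (v i).1).eval y ^ β i) (hO.mono fun x hx => ⟨hx.1, ?_⟩) (-a)
  · rw [← hinf]
    exact Finset.sum_congr rfl fun i hi => by rw [rootMult_eq (hIv i hi)]
  · refine prod_eval_eq_of_limitPoint_mem_orbit hR hβ hx.1 ?_
    rw [← hyO] at hx
    rw [← hx.2]
    exact mem_orbit_self _

end Necessity

end TorusSL2

theorem theorem1 {k s : ℕ} (χ : Fin s → Fin k → ℤ) (n : Fin s → ℕ) (v : TorusSL2.Space n) :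
    {O : Set (TorusSL2.Space n) | (∃ w, O = TorusSL2.orbit χ n w) ∧
        O ⊆ TorusSL2.zariskiClosure (TorusSL2.orbit χ n v)}.Finite ↔
      ∀ F : PointedCone ℚ ((Fin k → ℚ) × ℚ), TorusSL2.IsMaxAdmissibleFace χ v F →
        ∀ β : Fin s → ℤ, ∑ i ∈ TorusSL2.faceIndices χ v F, β i • χ i = 0 →
          ∀ a : ℂ, ∑ i ∈ TorusSL2.faceIndices χ v F,
            (TorusSL2.rootMult (v i) a : ℤ) * β i = 0 := by
  constructor
  · intro hfin F hF β hβ a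
    obtain ⟨R, hR, rfl⟩ := hF.1.exists_eq
    rw [TorusSL2.faceIndices_inf_orthCone] at hβ ⊢
    exact TorusSL2.sum_rootMult_eq_zero_of_finite hfin hR β hβ a
  · intro h
    exact TorusSL2.finite_orbits_of_forall fun R hR β hβ a =>
      TorusSL2.sum_rootMult_eq_zero_of_forall_isMaxAdmissibleFace h hR β hβ a
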